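/- Rings are associative with identity, modules are unitary. For a ring $R$, a left $R$-module is super finitely presented if it has a resolution $\cdots\to F_1\to F_0\to N\to 0$ by finitely generated projective modules. A left $R$-module $M$ is weak injective (class $\mathcal{WI}$) if $\operatorname{Ext}^1_R(N,M)=0$, and a right $R$-module $M$ is weak flat (class $\mathcal{WF}$) if $\operatorname{Tor}_1^R(M,N)=0$, for every super finitely presented left $R$-module $N$. For a class $\mathcal C$ of modules, a right $\mathcal C$-resolution of $M$ is a complex $0\to M\to W^0\to W^1\to\cdots$ with all $W^i\in\mathcal C$ such that $\operatorname{Hom}_R(-,W)$ makes it exact for every $W\in\mathcal C$. Every right $R$-module has a right $\mathcal{WF}$-resolution and every left $R$-module has a right $\mathcal{WI}$-resolution. Writing $W^\bullet$ for the deleted resolution (without $M$, beginning in degree $0$), put $\operatorname{Ext}^{\mathcal{WF}}_n(L,X)=H_n(\operatorname{Hom}_R(W^\bullet,X))$ for a right $\mathcal{WF}$-resolution of the right module $L$, and $\operatorname{Ext}^{\mathcal{WI}}_n(M,X)=H_n(\operatorname{Hom}_R(W^\bullet,X))$ for a right $\mathcal{WI}$-resolution of the left module $M$. For a right module $L$ and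 a left module $M$, $\operatorname{Tor}^n_{\mathcal W}(L,M)$ is $H^n(W^\bullet\otimes_R M)$ for a right $\mathcal{WF}$-resolution of $L$ or $H^n(L\otimes_R W^\bullet)$ for a right $\mathcal{WI}$-resolution of $M$; these are isomorphic abelian groups. Let $R$ and $S$ be rings and $n\ge 0$. The following isomorphisms of abelian groups hold, whichever resolutions are used on each side. (1) If $L$ is a right $R$-module, $M$ an $R$-$S$-bimodule and $N$ an injective right $S$-module, then $$\operatorname{Ext}^{\mathcal{WF}}_n(L,\operatorname{Hom}_S(M,N))\cong\operatorname{Hom}_S(\operatorname{Tor}^n_{\mathcal W}(L,M),N),$$ where $\operatorname{Tor}^n_{\mathcal W}(L,M)$ is computed with a right $\mathcal{WF}$-resolution of $L$ and is a right $S$-module through $M$. (2) If $L$ is an $S$-$R$-bimodule, $M$ a left $R$-module and $N$ an injective left $S$-module, then $$\operatorname{Ext}^{\mathcal{WI}}_n(M,\operatorname{Hom}_S(L,N))\cong\operatorname{Hom}_S(\operatorname{Tor}^n_{\mathcal W}(L,M),N),$$ where $\operatorname{Tor}^n_{\mathcal W}(L,M)$ is computed with a right $\mathcal{WI}$-resolution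 of $M$ and is a left $S$-module through $L$. (3) In particular, for a right $R$-module $M$ and a left $R$-module $N$, with $(-)^+=\operatorname{Hom}_{\mathbb Z}(-,\mathbb Q/\mathbb Z)$, $$\operatorname{Ext}^{\mathcal{WF}}_n(M,N^+)\cong\operatorname{Tor}^n_{\mathcal W}(M,N)^+\cong\operatorname{Ext}^{\mathcal{WI}}_n(N,M^+).$$ -/

import Mathlib

/-!
Conventions: a left `R`-module is a `Module R`, a right `R`-module is a `Module Rᵐᵒᵖ`, and an
`R`-`S`-bimodule is a module over `R` and over `Sᵐᵒᵖ` whose two actions commute.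
-/

open CategoryTheory TensorProduct MulOpposite

universe u v

namespace WeakDerived

/-! ### The tensor product over a noncommutative ring -/

section BalancedTensor

variable (R : Type u) [Ring R]

/-- The subgroup of `M ⊗[ℤ] N` generated by the elements `(m r) ⊗ n - m ⊗ (r n)`. -/
def balancedRel (M N : Type*) [AddCommGroup M] [Module Rᵐᵒᵖ M] [AddCommGroup N] [Module R N] :
    Submodule ℤ (M ⊗[ℤ] N) :=
  Submodule.span ℤ {x | ∃ (m : M) (r : R) (n : N), x = (op r • m) ⊗ₜ[ℤ] n - m ⊗ₜ[ℤ] (r • n)}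

/-- The tensor product `M ⊗_R N` of a right `R`-module `M` and a left `R`-module `N`. -/
def BTensor (M N : Type*) [AddCommGroup M] [Module Rᵐᵒᵖ M] [AddCommGroup N] [Module R N] :
    Type _ :=
  (M ⊗[ℤ] N) ⧸ balancedRel R M N

noncomputable section

variable {M M' M'' : Type*} [AddCommGroup M] [Module Rᵐᵒᵖ M] [AddCommGroup M'] [Module Rᵐᵒᵖ M']
  [AddCommGroup M''] [Module Rᵐᵒᵖ M'']
variable {N N' N'' : Type*} [AddCommGroup N] [Module R N] [AddCommGroup N'] [Module R N']
  [AddCommGroup N''] [Module R N'']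

instance : AddCommGroup (BTensor R M N) :=
  inferInstanceAs (AddCommGroup ((M ⊗[ℤ] N) ⧸ balancedRel R M N))

/-- The class of `m ⊗ n` in `M ⊗_R N`. -/
def btmul (m : M) (n : N) : BTensor R M N :=
  Submodule.Quotient.mk (p := balancedRel R M N) (m ⊗ₜ[ℤ] n)

variable {R} in
lemma BTensor.hom_ext {A : Type*} [AddCommGroup A] {f g : BTensor R M N →+ A}
    (h : ∀ (m : M) (n : N), f (btmul R m n) = g (btmul R m n)) : f = g := by
  refine AddMonoidHom.ext fun x => ?_
  obtain ⟨y, rfl⟩ := Submodule.Quotient.mk_surjective (balancedRel R M N) x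
  induction y using TensorProduct.induction_on with
  | zero => exact (map_zero f).trans (map_zero g).symm
  | tmul m n => exact h m n
  | add a b ha hb => exact (map_add f _ _).trans ((congrArg₂ _ ha hb).trans (map_add g _ _).symm)

variable {R} in
/-- The homomorphism `f ⊗ g : M ⊗_R N → M' ⊗_R N'`. -/
def BTensor.map (f : M →ₗ[Rᵐᵒᵖ] M') (g : N →ₗ[R] N') : BTensor R M N →+ BTensor R M' N' :=
  (Submodule.mapQ (balancedRel R M N) (balancedRel R M' N')
    (TensorProduct.map (f.toAddMonoidHom.toIntLinearMap) (g.toAddMonoidHom.toIntLinearMap)) (by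
      refine Submodule.span_le.2 ?_
      rintro _ ⟨m, r, n, rfl⟩
      refine Submodule.subset_span ⟨f m, r, g n, ?_⟩
      exact (map_sub (TensorProduct.map _ _) _ _).trans (congrArg₂ _
        (congrArg (· ⊗ₜ[ℤ] g n) (map_smul f (op r) m))
        (congrArg (f m ⊗ₜ[ℤ] ·) (map_smul g r n))))).toAddMonoidHom

@[simp]
lemma BTensor.map_btmul (f : M →ₗ[Rᵐᵒᵖ] M') (g : N →ₗ[R] N') (m : M) (n : N) :
    BTensor.map f g (btmul R m n) = btmul R (f m) (g n) := rfl

lemma btmul_add (m : M) (n n' : N) : btmul R m (n + n') = btmul R m n + btmul R m n' :=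
  congrArg (Submodule.Quotient.mk (p := balancedRel R M N)) (TensorProduct.tmul_add m n n')

lemma add_btmul (m m' : M) (n : N) : btmul R (m + m') n = btmul R m n + btmul R m' n :=
  congrArg (Submodule.Quotient.mk (p := balancedRel R M N)) (TensorProduct.add_tmul m m' n)

lemma zero_btmul (n : N) : btmul R (0 : M) n = 0 :=
  congrArg (Submodule.Quotient.mk (p := balancedRel R M N)) (TensorProduct.zero_tmul M n)

lemma btmul_zero (m : M) : btmul R m (0 : N) = 0 :=
  congrArg (Submodule.Quotient.mk (p := balancedRel R M N)) (TensorProduct.tmul_zero N m)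

lemma smul_btmul (r : R) (m : M) (n : N) : btmul R (op r • m) n = btmul R m (r • n) :=
  (Submodule.Quotient.eq (balancedRel R M N)).2 (Submodule.subset_span ⟨m, r, n, rfl⟩)

lemma BTensor.map_id (x : BTensor R M N) : BTensor.map LinearMap.id LinearMap.id x = x :=
  DFunLike.congr_fun (f := BTensor.map _ _) (g := AddMonoidHom.id _)
    (BTensor.hom_ext fun _ _ => rfl) x

variable {R} in
lemma BTensor.map_comp (f : M →ₗ[Rᵐᵒᵖ] M') (f' : M' →ₗ[Rᵐᵒᵖ] M'') (g : N →ₗ[R] N')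
    (g' : N' →ₗ[R] N'') (x : BTensor R M N) :
    BTensor.map (f'.comp f) (g'.comp g) x = BTensor.map f' g' (BTensor.map f g x) :=
  DFunLike.congr_fun (f := BTensor.map (f'.comp f) (g'.comp g))
    (g := (BTensor.map f' g').comp (BTensor.map f g))
    (BTensor.hom_ext fun m n => by simp) x

variable {R} in
lemma BTensor.map_add_left (f f' : M →ₗ[Rᵐᵒᵖ] M') (g : N →ₗ[R] N') (x : BTensor R M N) :
    BTensor.map (f + f') g x = BTensor.map f g x + BTensor.map f' g x :=
  DFunLike.congr_fun (g := BTensor.map f g + BTensor.map f' g)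
    (BTensor.hom_ext fun _ _ => add_btmul R _ _ _) x

variable {R} in
lemma BTensor.map_add_right (f : M →ₗ[Rᵐᵒᵖ] M') (g g' : N →ₗ[R] N') (x : BTensor R M N) :
    BTensor.map f (g + g') x = BTensor.map f g x + BTensor.map f g' x :=
  DFunLike.congr_fun (g := BTensor.map f g + BTensor.map f g')
    (BTensor.hom_ext fun _ _ => btmul_add R _ _ _) x

variable (T : Type v) [Ring T]

/-- If `T` acts on the right `R`-module `M` by `R`-linear maps, it acts on `M ⊗_R N` by
`t (m ⊗ n) = (t m) ⊗ n`. -/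
abbrev BTensor.moduleFst [Module T M] [SMulCommClass T Rᵐᵒᵖ M] : Module T (BTensor R M N) where
  smul t x := BTensor.map (Module.toModuleEnd Rᵐᵒᵖ (S := T) M t) LinearMap.id x
  smul_zero _ := map_zero _
  smul_add _ _ _ := map_add _ _ _
  one_smul x := by
    refine DFunLike.congr_fun (f := BTensor.map _ _) (g := AddMonoidHom.id _)
      (BTensor.hom_ext fun m n => ?_) x
    simp
  mul_smul s t x := by
    refine DFunLike.congr_fun (f := BTensor.map _ _)
      (g := (BTensor.map (Module.toModuleEnd Rᵐᵒᵖ (S := T) M s) LinearMap.id).comp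
        (BTensor.map (Module.toModuleEnd Rᵐᵒᵖ (S := T) M t) LinearMap.id))
      (BTensor.hom_ext fun m n => ?_) x
    simp [mul_smul]
  add_smul s t x := by
    refine DFunLike.congr_fun (f := BTensor.map _ _)
      (g := BTensor.map (Module.toModuleEnd Rᵐᵒᵖ (S := T) M s) LinearMap.id +
        BTensor.map (Module.toModuleEnd Rᵐᵒᵖ (S := T) M t) LinearMap.id)
      (BTensor.hom_ext fun m n => ?_) x
    simp [add_smul, add_btmul]
  zero_smul x := by
    refine DFunLike.congr_fun (f := BTensor.map _ _) (g := (0 : _ →+ BTensor R M N))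
      (BTensor.hom_ext fun m n => ?_) x
    simp [zero_btmul]

/-- If `T` acts on the left `R`-module `N` by `R`-linear maps, it acts on `M ⊗_R N` by
`t (m ⊗ n) = m ⊗ (t n)`. -/
abbrev BTensor.moduleSnd [Module T N] [SMulCommClass T R N] : Module T (BTensor R M N) where
  smul t x := BTensor.map LinearMap.id (Module.toModuleEnd R (S := T) N t) x
  smul_zero _ := map_zero _
  smul_add _ _ _ := map_add _ _ _
  one_smul x := by
    refine DFunLike.congr_fun (f := BTensor.map _ _) (g := AddMonoidHom.id _)
      (BTensor.hom_ext fun m n => ?_) x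
    simp
  mul_smul s t x := by
    refine DFunLike.congr_fun (f := BTensor.map _ _)
      (g := (BTensor.map LinearMap.id (Module.toModuleEnd R (S := T) N s)).comp
        (BTensor.map LinearMap.id (Module.toModuleEnd R (S := T) N t)))
      (BTensor.hom_ext fun m n => ?_) x
    simp [mul_smul]
  add_smul s t x := by
    refine DFunLike.congr_fun (f := BTensor.map _ _)
      (g := BTensor.map LinearMap.id (Module.toModuleEnd R (S := T) N s) +
        BTensor.map LinearMap.id (Module.toModuleEnd R (S := T) N t))
      (BTensor.hom_ext fun m n => ?_) x
    simp [add_smul, btmul_add]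
  zero_smul x := by
    refine DFunLike.congr_fun (f := BTensor.map _ _) (g := (0 : _ →+ BTensor R M N))
      (BTensor.hom_ext fun m n => ?_) x
    simp [btmul_zero]

end

end BalancedTensor

noncomputable section

section Functors

variable (R : Type u) [Ring R] (T : Type v) [Ring T]

section

attribute [local instance] BTensor.moduleFst

/-- For a right `R`-module `L` with a commuting action of `T`, the functor `L ⊗_R -` from left
`R`-modules to `T`-modules. -/
def tensorFrom (L : Type u) [AddCommGroup L] [Module Rᵐᵒᵖ L] [Module T L]
    [SMulCommClass T Rᵐᵒᵖ L] : ModuleCat.{u} R ⥤ ModuleCat.{u} T where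
  obj N := ModuleCat.of T (BTensor R L N)
  map {N N'} g :=
    ModuleCat.ofHom
      { toFun := BTensor.map LinearMap.id g.hom
        map_add' := map_add _
        map_smul' := fun t x => DFunLike.congr_fun
          (f := (BTensor.map LinearMap.id g.hom).comp
            (BTensor.map (Module.toModuleEnd Rᵐᵒᵖ (S := T) L t) LinearMap.id))
          (g := (BTensor.map (Module.toModuleEnd Rᵐᵒᵖ (S := T) L t) LinearMap.id).comp
            (BTensor.map LinearMap.id g.hom))
          (BTensor.hom_ext fun m n => by simp) x }
  map_id N := ModuleCat.hom_ext (LinearMap.ext fun x => BTensor.map_id R x)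
  map_comp {N _ _} g h := ModuleCat.hom_ext (LinearMap.ext fun x =>
    BTensor.map_comp LinearMap.id LinearMap.id g.hom h.hom x)

instance (L : Type u) [AddCommGroup L] [Module Rᵐᵒᵖ L] [Module T L] [SMulCommClass T Rᵐᵒᵖ L] :
    (tensorFrom R T L).Additive where
  map_add {_ _ g h} := ModuleCat.hom_ext (LinearMap.ext fun x =>
    BTensor.map_add_right LinearMap.id g.hom h.hom x)

end

section

attribute [local instance] BTensor.moduleSnd

/-- For a left `R`-module `M` with a commuting action of `T`, the functor `- ⊗_R M` from right
`R`-modules to `T`-modules. -/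
def tensorInto (M : Type u) [AddCommGroup M] [Module R M] [Module T M]
    [SMulCommClass T R M] : ModuleCat.{u} Rᵐᵒᵖ ⥤ ModuleCat.{u} T where
  obj L := ModuleCat.of T (BTensor R L M)
  map {L L'} g :=
    ModuleCat.ofHom
      { toFun := BTensor.map g.hom LinearMap.id
        map_add' := map_add _
        map_smul' := fun t x => DFunLike.congr_fun
          (f := (BTensor.map g.hom LinearMap.id).comp
            (BTensor.map LinearMap.id (Module.toModuleEnd R (S := T) M t)))
          (g := (BTensor.map LinearMap.id (Module.toModuleEnd R (S := T) M t)).comp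
            (BTensor.map g.hom LinearMap.id))
          (BTensor.hom_ext fun m n => by simp) x }
  map_id L := ModuleCat.hom_ext (LinearMap.ext fun x => BTensor.map_id R x)
  map_comp {L _ _} g h := ModuleCat.hom_ext (LinearMap.ext fun x =>
    BTensor.map_comp g.hom h.hom LinearMap.id LinearMap.id x)

instance (M : Type u) [AddCommGroup M] [Module R M] [Module T M] [SMulCommClass T R M] :
    (tensorInto R T M).Additive where
  map_add {_ _ g h} := ModuleCat.hom_ext (LinearMap.ext fun x =>
    BTensor.map_add_left g.hom h.hom LinearMap.id x)

end

/-! ### Homomorphism modules and character modules as one-sided modules -/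

/-- For `M` a left `R`-module with a commuting action of `T` and a `T`-module `N`, the right
`R`-module `Hom_T(M, N)`, with `(f r)(m) = f(r m)`. -/
def homRight (M N : Type u) [AddCommGroup M] [Module R M] [Module T M] [SMulCommClass T R M]
    [AddCommGroup N] [Module T N] : ModuleCat.{u} Rᵐᵒᵖ :=
  haveI : SMulCommClass R T M := SMulCommClass.symm T R M
  letI : Module Rᵐᵒᵖ (M →ₗ[T] N) :=
    { smul := fun r f => f.comp (Module.toModuleEnd T (S := R) M r.unop)
      one_smul := fun f => LinearMap.ext fun m => congrArg f (one_smul R m)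
      mul_smul := fun r s f => LinearMap.ext fun m => congrArg f (mul_smul s.unop r.unop m)
      smul_zero := fun _ => LinearMap.zero_comp _
      smul_add := fun _ _ _ => LinearMap.add_comp _ _ _
      add_smul := fun r s f => LinearMap.ext fun m =>
        (congrArg f (add_smul r.unop s.unop m)).trans (map_add f _ _)
      zero_smul := fun f => LinearMap.ext fun m =>
        (congrArg f (zero_smul R m)).trans (map_zero f) }
  ModuleCat.of Rᵐᵒᵖ (M →ₗ[T] N)

/-- For `L` a right `R`-module with a commuting action of `T` and a `T`-module `N`, the left
`R`-module `Hom_T(L, N)`, with `(r f)(l) = f(l r)`. -/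
def homLeft (L N : Type u) [AddCommGroup L] [Module Rᵐᵒᵖ L] [Module T L]
    [SMulCommClass T Rᵐᵒᵖ L] [AddCommGroup N] [Module T N] : ModuleCat.{u} R :=
  haveI : SMulCommClass Rᵐᵒᵖ T L := SMulCommClass.symm T Rᵐᵒᵖ L
  letI : Module R (L →ₗ[T] N) :=
    { smul := fun r f => f.comp (Module.toModuleEnd T (S := Rᵐᵒᵖ) L (op r))
      one_smul := fun f => LinearMap.ext fun l => congrArg f (one_smul Rᵐᵒᵖ l)
      mul_smul := fun r s f => LinearMap.ext fun l => congrArg f (mul_smul (op s) (op r) l)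
      smul_zero := fun _ => LinearMap.zero_comp _
      smul_add := fun _ _ _ => LinearMap.add_comp _ _ _
      add_smul := fun r s f => LinearMap.ext fun l =>
        (congrArg f (add_smul (op r) (op s) l)).trans (map_add f _ _)
      zero_smul := fun f => LinearMap.ext fun l =>
        (congrArg f (zero_smul Rᵐᵒᵖ l)).trans (map_zero f) }
  ModuleCat.of R (L →ₗ[T] N)

/-- The character module `N⁺ = Hom_ℤ(N, ℚ/ℤ)` of a left `R`-module, as a right `R`-module. -/
def charRight (N : ModuleCat.{u} R) : ModuleCat.{u} Rᵐᵒᵖ :=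
  letI : Module Rᵐᵒᵖ (CharacterModule N) :=
    { smul := fun r f => AddMonoidHom.comp f (DistribSMul.toAddMonoidHom N r.unop)
      one_smul := fun f => CharacterModule.ext _ fun m => congrArg f (one_smul R m)
      mul_smul := fun r s f => CharacterModule.ext _ fun m => congrArg f (mul_smul s.unop r.unop m)
      smul_zero := fun _ => AddMonoidHom.zero_comp _
      smul_add := fun _ _ _ => AddMonoidHom.add_comp _ _ _
      add_smul := fun r s f => CharacterModule.ext _ fun m =>
        (congrArg f (add_smul r.unop s.unop m)).trans (map_add f _ _)
      zero_smul := fun f => CharacterModule.ext _ fun m =>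
        (congrArg f (zero_smul R m)).trans (map_zero f) }
  ModuleCat.of Rᵐᵒᵖ (CharacterModule N)

/-- The character module `M⁺ = Hom_ℤ(M, ℚ/ℤ)` of a right `R`-module, as a left `R`-module. -/
def charLeft (M : ModuleCat.{u} Rᵐᵒᵖ) : ModuleCat.{u} R :=
  letI : Module R (CharacterModule M) :=
    { smul := fun r f => AddMonoidHom.comp f (DistribSMul.toAddMonoidHom M (op r))
      one_smul := fun f => CharacterModule.ext _ fun m => congrArg f (one_smul Rᵐᵒᵖ m)
      mul_smul := fun r s f => CharacterModule.ext _ fun m => congrArg f (mul_smul (op s) (op r) m)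
      smul_zero := fun _ => AddMonoidHom.zero_comp _
      smul_add := fun _ _ _ => AddMonoidHom.add_comp _ _ _
      add_smul := fun r s f => CharacterModule.ext _ fun m =>
        (congrArg f (add_smul (op r) (op s) m)).trans (map_add f _ _)
      zero_smul := fun f => CharacterModule.ext _ fun m =>
        (congrArg f (zero_smul Rᵐᵒᵖ m)).trans (map_zero f) }
  ModuleCat.of R (CharacterModule M)

end Functors

/-! ### Weak injective and weak flat modules -/

section Classes

variable {R : Type u} [Ring R]

/-- `N` has a resolution `⋯ → F₁ → F₀ → N → 0` by finitely generated projective modules. -/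
def IsSuperFinitelyPresented (N : ModuleCat.{u} R) : Prop :=
  ∃ F : ProjectiveResolution N, ∀ i, Module.Finite R (F.complex.X i)

/-- `Tor_n^R(M, N)`, as the `n`-th left derived functor of `M ⊗_R -`. -/
def classicalTor (M : ModuleCat.{u} Rᵐᵒᵖ) (n : ℕ) (N : ModuleCat.{u} R) : ModuleCat.{u} ℤ :=
  ((tensorFrom R ℤ M).leftDerived n).obj N

/-- A left `R`-module `M` is weak injective if `Ext¹_R(N, M) = 0` for all super finitely presented
left `R`-modules `N`. -/
def IsWeakInjective : ObjectProperty (ModuleCat.{u} R) := fun M =>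
  ∀ N : ModuleCat.{u} R, IsSuperFinitelyPresented N → Subsingleton (Abelian.Ext N M 1)

/-- A right `R`-module `M` is weak flat if `Tor₁^R(M, N) = 0` for all super finitely presented
left `R`-modules `N`. -/
def IsWeakFlat : ObjectProperty (ModuleCat.{u} Rᵐᵒᵖ) := fun M =>
  ∀ N : ModuleCat.{u} R, IsSuperFinitelyPresented N → Subsingleton (classicalTor M 1 N)

end Classes

/-! ### Relative resolutions and relative derived functors -/

/-- A right `𝒲`-resolution of `M`: a complex `0 → M → W⁰ → W¹ → ⋯` with all `Wⁱ` in `𝒲` which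
`Hom(-, W)` turns into an exact sequence `⋯ → Hom(W¹, W) → Hom(W⁰, W) → Hom(M, W) → 0` for all
`W` in `𝒲`. The field `complex` is the deleted resolution. -/
structure RightResolution {C : Type*} [Category C] [Preadditive C] (𝒲 : ObjectProperty C)
    (M : C) where
  complex : CochainComplex C ℕ
  ι : M ⟶ complex.X 0
  ι_d : ι ≫ complex.d 0 1 = 0
  mem : ∀ i, 𝒲 (complex.X i)
  exact_aug : ∀ W, 𝒲 W → ∀ f : M ⟶ W, ∃ g : complex.X 0 ⟶ W, ι ≫ g = f
  exact_zero : ∀ W, 𝒲 W → ∀ g : complex.X 0 ⟶ W, ι ≫ g = 0 →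
    ∃ h : complex.X 1 ⟶ W, complex.d 0 1 ≫ h = g
  exact_succ : ∀ W, 𝒲 W → ∀ (i : ℕ) (g : complex.X (i + 1) ⟶ W),
    complex.d i (i + 1) ≫ g = 0 → ∃ h : complex.X (i + 2) ⟶ W, complex.d (i + 1) (i + 2) ≫ h = g

/-- `Ext^𝒲_n(M, X)`, computed with the right `𝒲`-resolution `P` of `M`: the `n`-th homology group
of the chain complex `⋯ → Hom(W¹, X) → Hom(W⁰, X) → 0`. -/
def relExt {C : Type*} [Category.{u} C] [Preadditive C] {𝒲 : ObjectProperty C} {M : C}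
    (P : RightResolution 𝒲 M) (X : C) (n : ℕ) : AddCommGrpCat.{u} :=
  (((preadditiveYoneda.obj X).mapHomologicalComplex _).obj P.complex.op).homology n

variable {R : Type u} [Ring R]

/-- `Tor^n_𝒲(L, M)` computed with a right `𝒲ℱ`-resolution `P` of the right `R`-module `L`: the
`n`-th cohomology of `0 → W⁰ ⊗_R M → W¹ ⊗_R M → ⋯`, a `T`-module whenever `T` acts on `M`. -/
def relTorFlat {L : ModuleCat.{u} Rᵐᵒᵖ} (P : RightResolution IsWeakFlat L) (T : Type v) [Ring T]
    (M : Type u) [AddCommGroup M] [Module R M] [Module T M] [SMulCommClass T R M] (n : ℕ) :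
    ModuleCat.{u} T :=
  (((tensorInto R T M).mapHomologicalComplex _).obj P.complex).homology n

/-- `Tor^n_𝒲(L, M)` computed with a right `𝒲ℐ`-resolution `Q` of the left `R`-module `M`: the
`n`-th cohomology of `0 → L ⊗_R W⁰ → L ⊗_R W¹ → ⋯`, a `T`-module whenever `T` acts on `L`. -/
def relTorInj {M : ModuleCat.{u} R} (Q : RightResolution IsWeakInjective M) (T : Type v) [Ring T]
    (L : Type u) [AddCommGroup L] [Module Rᵐᵒᵖ L] [Module T L] [SMulCommClass T Rᵐᵒᵖ L] (n : ℕ) :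
    ModuleCat.{u} T :=
  (((tensorFrom R T L).mapHomologicalComplex _).obj Q.complex).homology n

end

end WeakDerived

/-! The adjunction Hom_R(W, Hom_T(M, N)) ≅ Hom_T(W ⊗_R M, N) is natural in W. Applied to the terms
of a resolution, it turns the complex computing relative Ext into the `N`-dual of the complex
computing relative Tor. For injective `N` dualizing is exact, hence commutes with homology
(`HomDuality.nonempty_homology_addEquiv`). Two right resolutions of one object are homotopy
equivalent (`RightResolution.nonempty_homotopyEquiv`) and additive functors preserve this, so each
side may use its own resolution.

Resolutions exist because both classes are injectivity classes for a small set of morphisms: weak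
injectivity by writing Ext¹ with cocycles, weak flatness after replacing M ⊗ F by Hom(F^*, M) for
finitely generated projective F. Every map from M to a member of such a class factors through a
member that is a quotient of a fixed set of formal expressions. The product of all such members
under M is a preenvelope, and iterating preenvelopes and cokernels gives a resolution.

For the balance of Tor, duality into ℚ/ℤ exchanges the two classes (`isWeakInjective_homLeft`,
`isWeakFlat_homRight`). Since characters detect exactness, a weak flat resolution tensored with a
weak injective module stays exact, and symmetrically. The augmented rows and columns of P ⊗ Q are
therefore exact, and a chase along antidiagonals identifies the cohomology of its two edges. -/

namespace WeakDerived

/-! ### Preenvelopes -/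

section Preenvelope

variable {Λ : Type u} [Ring Λ] {ι : Type u} {P Q : ι → ModuleCat.{u} Λ} (h : ∀ i, P i ⟶ Q i)

/-- The modules which are injective with respect to all morphisms `h i`. -/
def injectivityClass : ObjectProperty (ModuleCat.{u} Λ) := fun W =>
  ∀ (i : ι) (x : P i ⟶ W), ∃ y : Q i ⟶ W, h i ≫ y = x

/-- Formal expressions in the elements of `M`, the module operations and values of extensions along
the morphisms `h i`. -/
inductive Term (P Q : ι → ModuleCat.{u} Λ) (M : ModuleCat.{u} Λ) : Type u
  | of (m : M) : Term P Q M
  | add (s t : Term P Q M) : Term P Q M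
  | smul (r : Λ) (t : Term P Q M) : Term P Q M
  | ext (i : ι) (x : P i → Term P Q M) (q : Q i) : Term P Q M

variable {h} {M F : ModuleCat.{u} Λ}

open Classical in
/-- The value of an expression in a module of the injectivity class. -/
noncomputable def Term.eval (hF : injectivityClass h F) (f : M ⟶ F) : Term P Q M → F
  | of m => f m
  | add s t => s.eval hF f + t.eval hF f
  | smul r t => r • t.eval hF f
  | ext i x q =>
    -- The family `x` is arbitrary, so its values need not form a morphism; such expressions get the
    -- junk value 0.
    if hx : ∃ g : P i ⟶ F, ∀ p, g p = (x p).eval hF f then (hF i hx.choose).choose q else 0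

/-- The values of all expressions form a submodule. -/
noncomputable def Term.evalRange (hF : injectivityClass h F) (f : M ⟶ F) : Submodule Λ F where
  carrier := Set.range (Term.eval hF f)
  add_mem' := by
    rintro _ _ ⟨s, rfl⟩ ⟨t, rfl⟩
    exact ⟨.add s t, rfl⟩
  zero_mem' := ⟨.of 0, map_zero f.hom⟩
  smul_mem' := by
    rintro r _ ⟨t, rfl⟩
    exact ⟨.smul r t, rfl⟩

/-- A morphism into the submodule can be written pointwise by expressions, and `Term.ext` then names
every value of the chosen extension, which therefore does not leave the submodule. -/
lemma Term.injectivityClass_evalRange (hF : injectivityClass h F) (f : M ⟶ F) :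
    injectivityClass h (ModuleCat.of Λ (Term.evalRange hF f)) := by
  intro i x
  choose t ht using fun p => (x p).2
  have hx : ∃ g : P i ⟶ F, ∀ p, g p = (t p).eval hF f :=
    ⟨x ≫ ModuleCat.ofHom (Submodule.subtype _), fun p => (ht p).symm⟩
  have hy : ∀ q, (hF i hx.choose).choose q ∈ Term.evalRange hF f := fun q =>
    ⟨.ext i t q, by rw [Term.eval, dif_pos hx]⟩
  refine ⟨ModuleCat.ofHom (LinearMap.codRestrict _ (hF i hx.choose).choose.hom hy), ?_⟩
  refine ModuleCat.hom_ext (LinearMap.ext fun p => Subtype.ext ?_)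
  have := ConcreteCategory.congr_hom (hF i hx.choose).choose_spec p
  exact this.trans ((hx.choose_spec p).trans (ht p))

lemma injectivityClass_of_iso {W W' : ModuleCat.{u} Λ} (e : W ≅ W') (hW : injectivityClass h W) :
    injectivityClass h W' := by
  intro i x
  obtain ⟨y, hy⟩ := hW i (x ≫ e.inv)
  exact ⟨y ≫ e.hom, by rw [← Category.assoc, hy]; simp⟩

variable (h M) in
/-- The small members of the injectivity class under `M`. -/
structure SmallQuotient where
  rel : Setoid (Term P Q M)
  [grp : AddCommGroup (_root_.Quotient rel)]
  [mod : Module Λ (_root_.Quotient rel)]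
  map : M →ₗ[Λ] _root_.Quotient rel
  mem : injectivityClass h (ModuleCat.of Λ (_root_.Quotient rel))

attribute [instance] SmallQuotient.grp SmallQuotient.mod

/-- The submodule of values is the quotient of `Term P Q M` by the kernel of evaluation, so its
module structure transports to that quotient. -/
lemma exists_smallQuotient (hF : injectivityClass h F) (f : M ⟶ F) :
    ∃ (S : SmallQuotient h M) (g : _root_.Quotient S.rel →ₗ[Λ] F), g ∘ₗ S.map = f.hom := by
  let φ : Term P Q M → Term.evalRange hF f := fun t => ⟨t.eval hF f, t, rfl⟩
  have hφ : Function.Surjective φ := by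
    rintro ⟨_, t, rfl⟩
    exact ⟨t, rfl⟩
  let e := Setoid.quotientKerEquivOfSurjective φ hφ
  let _ : AddCommGroup (_root_.Quotient (Setoid.ker φ)) := e.addCommGroup
  let _ : Module Λ (_root_.Quotient (Setoid.ker φ)) := e.module Λ
  let e' : Quotient (Setoid.ker φ) ≃ₗ[Λ] Term.evalRange hF f := e.linearEquiv Λ
  refine ⟨{ rel := Setoid.ker φ
            map := e'.symm.toLinearMap ∘ₗ f.hom.codRestrict _ fun m => ⟨.of m, rfl⟩
            mem := injectivityClass_of_iso (LinearEquiv.toModuleIso e'.symm)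
              (Term.injectivityClass_evalRange hF f) },
    (Submodule.subtype _) ∘ₗ e'.toLinearMap, ?_⟩
  ext m
  simp only [LinearMap.comp_apply, LinearEquiv.coe_coe, LinearEquiv.apply_symm_apply]
  rfl

variable (h M) in
/-- An injectivity class is preenveloping. -/
theorem exists_preenvelope : ∃ (W : ModuleCat.{u} Λ) (f : M ⟶ W), injectivityClass h W ∧
    ∀ W' : ModuleCat.{u} Λ, injectivityClass h W' → ∀ g : M ⟶ W', ∃ k : W ⟶ W', f ≫ k = g := by
  -- `Term P Q M` lies in `Type u`, hence so do its setoids and the module structures on the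
  -- quotients; the product over all of them stays in universe `u`.
  refine ⟨ModuleCat.of Λ (∀ S : SmallQuotient h M, _root_.Quotient S.rel),
    ModuleCat.ofHom (LinearMap.pi fun S => S.map), fun i x => ?_, fun W' hW' g => ?_⟩
  · choose y hy using fun S : SmallQuotient h M =>
      S.mem i (x ≫ ModuleCat.ofHom (LinearMap.proj (φ := fun S => _root_.Quotient S.rel) S))
    refine ⟨ModuleCat.ofHom (LinearMap.pi fun S => (y S).hom), ?_⟩
    refine ModuleCat.hom_ext (LinearMap.ext fun p => funext fun S => ?_)
    exact ConcreteCategory.congr_hom (hy S) p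
  · obtain ⟨S, k, hk⟩ := exists_smallQuotient hW' g
    exact ⟨ModuleCat.ofHom (k ∘ₗ LinearMap.proj S), ModuleCat.hom_ext hk⟩

end Preenvelope

section Resolution

variable {C : Type*} [Category C] [Abelian C] {𝒲 : ObjectProperty C}

/-- If every object has a `𝒲`-preenvelope, then every object has a right `𝒲`-resolution. -/
theorem nonempty_rightResolution
    (H : ∀ M : C, ∃ (W : C) (f : M ⟶ W), 𝒲 W ∧
      ∀ W', 𝒲 W' → ∀ g : M ⟶ W', ∃ k : W ⟶ W', f ≫ k = g) (M : C) :
    Nonempty (RightResolution 𝒲 M) := by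
  choose W f hW hf using H
  -- `K (n + 1)` is the cokernel of the preenvelope of `K n`; the preenvelopes need not be
  -- monomorphisms.
  let K : ℕ → C := fun n => Nat.rec (motive := fun _ => C) M (fun _ X => Limits.cokernel (f X)) n
  let d : ∀ n, W (K n) ⟶ W (K (n + 1)) := fun n =>
    Limits.cokernel.π (f (K n)) ≫ f (K (n + 1))
  have fd : ∀ n, f (K n) ≫ d n = 0 := fun n => by simp [d]
  -- A map killed by the preenvelope of `K n` descends to the cokernel `K (n + 1)` and then extends
  -- over its preenvelope.
  have key : ∀ (n : ℕ) (W'), 𝒲 W' → ∀ g : W (K n) ⟶ W', f (K n) ≫ g = 0 →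
      ∃ k, d n ≫ k = g := fun n W' hW' g hg => by
    obtain ⟨k, hk⟩ := hf (K (n + 1)) W' hW' (Limits.cokernel.desc _ g hg)
    exact ⟨k, by rw [Category.assoc, hk]; exact Limits.cokernel.π_desc _ g hg⟩
  have dd : ∀ n, d n ≫ d (n + 1) = 0 := fun n =>
    (Category.assoc _ _ _).trans ((congrArg _ (fd (n + 1))).trans Limits.comp_zero)
  have hd : ∀ n, (CochainComplex.of (fun n => W (K n)) d dd).d n (n + 1) = d n :=
    fun n => CochainComplex.of_d (fun n => W (K n)) d n
  refine ⟨{ complex := CochainComplex.of (fun n => W (K n)) d dd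
            ι := f M
            ι_d := by rw [hd]; exact fd 0
            mem := fun i => hW _
            exact_aug := fun W' hW' g => hf M W' hW' g
            exact_zero := fun W' hW' g hg => by rw [hd]; exact key 0 W' hW' g hg
            exact_succ := fun W' hW' i g hg => by
              rw [hd] at hg ⊢
              refine key (i + 1) W' hW' g ?_
              rw [← cancel_epi (Limits.cokernel.π (f (K i))), Limits.comp_zero,
                ← Category.assoc]
              exact hg }⟩

end Resolution

/-! ### Maps out of the balanced tensor product -/

section Lift

variable {R : Type u} [Ring R]
  {M N : Type*} [AddCommGroup M] [Module Rᵐᵒᵖ M] [AddCommGroup N] [Module R N]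
  {A : Type*} [AddCommGroup A]

/-- The homomorphism on `M ⊗_R N` induced by a balanced biadditive map. -/
def BTensor.lift (f : M →+ N →+ A) (hf : ∀ m (r : R) n, f (op r • m) n = f m (r • n)) :
    BTensor R M N →+ A :=
  ((balancedRel R M N).liftQ
    (TensorProduct.liftAddHom (R := ℤ) f (by simp)).toIntLinearMap (by
      refine Submodule.span_le.2 ?_
      rintro _ ⟨m, r, n, rfl⟩
      simpa [sub_eq_zero] using hf m r n)).toAddMonoidHom

lemma BTensor.induction {p : BTensor R M N → Prop} (h0 : p 0)
    (ht : ∀ m n, p (btmul R m n)) (ha : ∀ x y, p x → p y → p (x + y)) (x : BTensor R M N) :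
    p x := by
  obtain ⟨y, rfl⟩ := Submodule.Quotient.mk_surjective (balancedRel R M N) x
  induction y using TensorProduct.induction_on with
  | zero => exact h0
  | tmul m n => exact ht m n
  | add a b h h' => exact ha _ _ h h'

end Lift

/-! ### Criteria in terms of a projective resolution -/

section Criteria

variable {R : Type u} [Ring R]

lemma subsingleton_ext_one_iff {N : ModuleCat.{u} R} (F : ProjectiveResolution N)
    (M : ModuleCat.{u} R) :
    Subsingleton (Abelian.Ext N M 1) ↔ ∀ x : F.complex.X 1 ⟶ M, F.complex.d 2 1 ≫ x = 0 →
      ∃ y : F.complex.X 0 ⟶ M, F.complex.d 1 0 ≫ y = x := by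
  constructor
  · intro _ x hx
    exact (F.extMk_eq_zero_iff x 2 rfl hx 0 rfl).1 (Subsingleton.elim _ _)
  · intro H
    refine subsingleton_of_forall_eq 0 fun α => ?_
    obtain ⟨x, hx, rfl⟩ := F.extMk_surjective α 2 rfl
    exact (F.extMk_eq_zero_iff x 2 rfl hx 0 rfl).2 (H x hx)

/-- Derived functors can be computed from any projective resolution, and vanishing homology is
exactness at degree 1. -/
lemma subsingleton_classicalTor_one_iff {N : ModuleCat.{u} R} (F : ProjectiveResolution N)
    (M : ModuleCat.{u} Rᵐᵒᵖ) :
    Subsingleton (classicalTor M 1 N) ↔ ∀ x : BTensor R M (F.complex.X 1),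
      BTensor.map LinearMap.id (F.complex.d 1 0).hom x = 0 →
      ∃ y : BTensor R M (F.complex.X 2),
        BTensor.map LinearMap.id (F.complex.d 2 1).hom y = x := by
  have e := F.isoLeftDerivedObj (tensorFrom R ℤ M) 1
  rw [← ModuleCat.isZero_iff_subsingleton (M := classicalTor M 1 N)]
  refine (Iso.isZero_iff e).trans ?_
  refine (HomologicalComplex.exactAt_iff_isZero_homology _ _).symm.trans ?_
  rw [HomologicalComplex.exactAt_iff' _ 2 1 0 (by simp) (by simp), ShortComplex.moduleCat_exact_iff]
  rfl

/-- Transport of a projective resolution along an isomorphism. -/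
noncomputable def projectiveResolutionOfIso {N N' : ModuleCat.{u} R} (F : ProjectiveResolution N)
    (e : N ≅ N') : ProjectiveResolution N' where
  complex := F.complex
  π := F.π ≫ (ChainComplex.single₀ (ModuleCat.{u} R)).map e.hom

variable (R) in
/-- A small set of representatives of the super finitely presented modules. -/
def SmallSFP : Type u :=
  {p : Σ n : ℕ, Submodule R (Fin n → R) //
    IsSuperFinitelyPresented (ModuleCat.of R ((Fin p.1 → R) ⧸ p.2))}

/-- The module belonging to an element of `SmallSFP R`. -/
abbrev SmallSFP.module (p : SmallSFP R) : ModuleCat.{u} R :=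
  ModuleCat.of R ((Fin p.1.1 → R) ⧸ p.1.2)

/-- A projective resolution by finitely generated modules. -/
noncomputable def SmallSFP.resolution (p : SmallSFP R) : ProjectiveResolution p.module :=
  p.2.choose

instance (p : SmallSFP R) (i : ℕ) : Module.Finite R (p.resolution.complex.X i) :=
  p.2.choose_spec i

/-- The surjection from the finitely generated F₀ makes `N` a quotient of some Rⁿ. This allows tests
over all super finitely presented modules to be indexed by a type in universe `u`. -/
lemma exists_smallSFP_iso {N : ModuleCat.{u} R} (hN : IsSuperFinitelyPresented N) :
    ∃ p : SmallSFP R, Nonempty (p.module ≅ N) := by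
  obtain ⟨F, hF⟩ := hN
  have hπ : Function.Surjective (F.π.f 0).hom := (ModuleCat.epi_iff_surjective _).1 inferInstance
  have := hF 0
  have : Module.Finite R N := Module.Finite.of_surjective (F.π.f 0).hom hπ
  obtain ⟨n, f, hf⟩ := Module.Finite.exists_fin' R N
  let e : ModuleCat.of R ((Fin n → R) ⧸ LinearMap.ker f) ≅ N :=
    (f.quotKerEquivOfSurjective hf).toModuleIso
  exact ⟨⟨⟨n, LinearMap.ker f⟩, projectiveResolutionOfIso F e.symm, hF⟩, ⟨e⟩⟩

/-- Transporting a resolution along an isomorphism keeps its complex, so one resolution for each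
representative suffices as a test. -/
lemma isWeakInjective_iff (M : ModuleCat.{u} R) :
    IsWeakInjective M ↔ ∀ (p : SmallSFP R) (x : p.resolution.complex.X 1 ⟶ M),
      p.resolution.complex.d 2 1 ≫ x = 0 →
      ∃ y : p.resolution.complex.X 0 ⟶ M, p.resolution.complex.d 1 0 ≫ y = x := by
  refine ⟨fun H p => (subsingleton_ext_one_iff _ M).1 (H _ p.2), fun H N hN => ?_⟩
  obtain ⟨p, ⟨e⟩⟩ := exists_smallSFP_iso hN
  exact (subsingleton_ext_one_iff (projectiveResolutionOfIso p.resolution e) M).2 (H p)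

lemma isWeakFlat_iff (M : ModuleCat.{u} Rᵐᵒᵖ) :
    IsWeakFlat M ↔ ∀ (p : SmallSFP R) (x : BTensor R M (p.resolution.complex.X 1)),
      BTensor.map LinearMap.id (p.resolution.complex.d 1 0).hom x = 0 →
      ∃ y : BTensor R M (p.resolution.complex.X 2),
        BTensor.map LinearMap.id (p.resolution.complex.d 2 1).hom y = x := by
  refine ⟨fun H p => (subsingleton_classicalTor_one_iff _ M).1 (H _ p.2), fun H N hN => ?_⟩
  obtain ⟨p, ⟨e⟩⟩ := exists_smallSFP_iso hN
  exact (subsingleton_classicalTor_one_iff (projectiveResolutionOfIso p.resolution e) M).2 (H p)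

end Criteria

/-! ### Tensor products with finitely generated projective modules -/

section FiniteProjective

variable {R : Type u} [Ring R]

lemma exists_dual_basis (F : Type*) [AddCommGroup F] [Module R F] [Module.Finite R F]
    [Module.Projective R F] :
    ∃ (n : ℕ) (b : Fin n → F) (c : Fin n → F →ₗ[R] R), ∀ x, ∑ k, c k x • b k = x := by
  obtain ⟨n, f, g, -, -, hfg⟩ := Module.Finite.exists_comp_eq_id_of_projective R F
  refine ⟨n, fun k => f (Pi.single k 1), fun k => LinearMap.proj k ∘ₗ g, fun x => ?_⟩
  conv_rhs => rw [← LinearMap.id_apply (R := R) x, ← hfg, LinearMap.comp_apply,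
    pi_eq_sum_univ' (g x)]
  simp

section Dual

variable {F F' F'' : Type*} [AddCommGroup F] [Module R F] [AddCommGroup F'] [Module R F']
  {M : Type*} [AddCommGroup M] [Module Rᵐᵒᵖ M]

/-- The transpose of a linear map, as a map of right modules. -/
def transpose (f : F →ₗ[R] F') : (F' →ₗ[R] R) →ₗ[Rᵐᵒᵖ] (F →ₗ[R] R) where
  toFun φ := φ ∘ₗ f
  map_add' _ _ := rfl
  map_smul' _ _ := rfl

variable (F M) in
/-- The canonical map `M ⊗_R F → Hom_R(F^*, M)`. -/
def toHomDual : BTensor R M F →+ ((F →ₗ[R] R) →ₗ[Rᵐᵒᵖ] M) :=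
  BTensor.lift
    (AddMonoidHom.mk' (fun m => AddMonoidHom.mk'
      (fun x => ({ toFun := fun φ => op (φ x) • m
                   map_add' := fun φ ψ => by simp [add_smul]
                   map_smul' := fun r φ => by simp [mul_smul] } : (F →ₗ[R] R) →ₗ[Rᵐᵒᵖ] M))
      fun x y => by ext φ; simp [add_smul])
      fun m m' => by ext x φ; simp)
    (fun m r x => by ext φ; simp [mul_smul])

lemma toHomDual_btmul (m : M) (x : F) (φ : F →ₗ[R] R) :
    toHomDual F M (btmul R m x) φ = op (φ x) • m := rfl

lemma toHomDual_map (f : F →ₗ[R] F') (x : BTensor R M F) :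
    toHomDual F' M (BTensor.map LinearMap.id f x) = toHomDual F M x ∘ₗ transpose f := by
  induction x using BTensor.induction with
  | h0 => simp
  | ht m n => rfl
  | ha x y hx hy => simp [hx, hy, LinearMap.add_comp]

/-- With a dual basis `b`, `c` of `F`, the inverse is θ ↦ ∑ θ(c_k) ⊗ b_k. -/
lemma toHomDual_bijective [Module.Finite R F] [Module.Projective R F] :
    Function.Bijective (toHomDual (R := R) F M) := by
  obtain ⟨n, b, c, h⟩ := exists_dual_basis (R := R) F
  have key : ∀ x : BTensor R M F, ∑ k, btmul R (toHomDual F M x (c k)) (b k) = x := by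
    intro x
    induction x using BTensor.induction with
    | h0 => simp [zero_btmul]
    | ht m x =>
      simp only [toHomDual_btmul, smul_btmul]
      conv_rhs => rw [← h x]
      exact (map_sum (AddMonoidHom.mk' (btmul R m) (btmul_add R m)) _ _).symm
    | ha x y hx hy =>
      simp only [map_add, LinearMap.add_apply, add_btmul, Finset.sum_add_distrib, hx, hy]
  refine ⟨fun x y hxy => by rw [← key x, ← key y, hxy], fun θ =>
    ⟨∑ k, btmul R (θ (c k)) (b k), LinearMap.ext fun φ => ?_⟩⟩
  have hφ : ∑ k, op (φ (b k)) • c k = φ := by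
    refine LinearMap.ext fun x => ?_
    conv_rhs => rw [← h x]
    simp
  conv_rhs => rw [← hφ]
  simp [toHomDual_btmul]

end Dual

/-- The isomorphisms `toHomDual` are natural, so a tensor condition on `M` becomes an extension
condition for morphisms into `M`. This is what makes weak flatness an injectivity class. -/
lemma exact_tensor_iff {F₀ F₁ F₂ : ModuleCat.{u} R} [Module.Finite R F₀] [Module.Finite R F₁]
    [Module.Finite R F₂] [Module.Projective R F₀] [Module.Projective R F₁]
    [Module.Projective R F₂] (d₁ : F₁ →ₗ[R] F₀) (d₂ : F₂ →ₗ[R] F₁) (M : ModuleCat.{u} Rᵐᵒᵖ) :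
    (∀ x : BTensor R M F₁, BTensor.map LinearMap.id d₁ x = 0 →
      ∃ y : BTensor R M F₂, BTensor.map LinearMap.id d₂ y = x) ↔
    ∀ x : (F₁ →ₗ[R] R) →ₗ[Rᵐᵒᵖ] M, x ∘ₗ transpose d₁ = 0 →
      ∃ y : (F₂ →ₗ[R] R) →ₗ[Rᵐᵒᵖ] M, y ∘ₗ transpose d₂ = x := by
  constructor
  · intro H θ hθ
    obtain ⟨x, rfl⟩ := toHomDual_bijective.2 θ
    obtain ⟨y, hy⟩ := H x (toHomDual_bijective.1 (by rw [toHomDual_map, hθ, map_zero]))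
    exact ⟨toHomDual _ _ y, by rw [← toHomDual_map, hy]⟩
  · intro H x hx
    obtain ⟨θ, hθ⟩ := H (toHomDual _ _ x) (by rw [← toHomDual_map, hx, map_zero])
    obtain ⟨y, rfl⟩ := toHomDual_bijective.2 θ
    exact ⟨y, toHomDual_bijective.1 (by rw [toHomDual_map, hθ])⟩

end FiniteProjective

/-! ### Existence of resolutions -/

section Existence

variable {R : Type u} [Ring R]

instance (p : SmallSFP R) (i : ℕ) : Module.Projective R (p.resolution.complex.X i) :=
  (IsProjective.iff_projective _).2 (p.resolution.projective i)

/-- A cocycle F₁ → M is a morphism from coker(F₂ → F₁), and it is a coboundary when it extends along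
coker(F₂ → F₁) → F₀. These are the test morphisms. -/
theorem nonempty_weakInjective_resolution (M : ModuleCat.{u} R) :
    Nonempty (RightResolution IsWeakInjective M) := by
  let h : ∀ p : SmallSFP R, Limits.cokernel (p.resolution.complex.d 2 1) ⟶
      p.resolution.complex.X 0 := fun p =>
    Limits.cokernel.desc _ (p.resolution.complex.d 1 0) (p.resolution.complex.d_comp_d 2 1 0)
  have hh : IsWeakInjective = injectivityClass h := by
    ext M
    rw [isWeakInjective_iff]
    refine forall_congr' fun p => ⟨fun H x => ?_, fun H x hx => ?_⟩
    · obtain ⟨y, hy⟩ := H (Limits.cokernel.π _ ≫ x) (by simp)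
      exact ⟨y, by rw [← cancel_epi (Limits.cokernel.π _), ← hy]; simp [h]⟩
    · obtain ⟨y, hy⟩ := H (Limits.cokernel.desc _ x hx)
      exact ⟨y, by rw [← Limits.cokernel.π_desc _ x hx, ← hy]; simp [h]⟩
  rw [hh]
  exact nonempty_rightResolution (exists_preenvelope h) M

/-- After dualizing the resolution, the test morphisms are coker(F₀^* → F₁^*) → F₂^*. -/
theorem nonempty_weakFlat_resolution (M : ModuleCat.{u} Rᵐᵒᵖ) :
    Nonempty (RightResolution (IsWeakFlat (R := R)) M) := by
  let t : ∀ (p : SmallSFP R) (i j : ℕ), ModuleCat.of Rᵐᵒᵖ (p.resolution.complex.X j →ₗ[R] R) ⟶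
      ModuleCat.of Rᵐᵒᵖ (p.resolution.complex.X i →ₗ[R] R) := fun p i j =>
    ModuleCat.ofHom (transpose (p.resolution.complex.d i j).hom)
  have ht : ∀ p, t p 1 0 ≫ t p 2 1 = 0 := fun p => ModuleCat.hom_ext <| LinearMap.ext fun φ =>
    LinearMap.ext fun x => (congrArg φ (ConcreteCategory.congr_hom
      (p.resolution.complex.d_comp_d 2 1 0) x)).trans (map_zero φ)
  let h : ∀ p : SmallSFP R, Limits.cokernel (t p 1 0) ⟶
      ModuleCat.of Rᵐᵒᵖ (p.resolution.complex.X 2 →ₗ[R] R) := fun p =>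
    Limits.cokernel.desc _ (t p 2 1) (ht p)
  have hh : IsWeakFlat (R := R) = injectivityClass h := by
    ext M
    rw [isWeakFlat_iff]
    refine forall_congr' fun p => (exact_tensor_iff _ _ M).trans ⟨fun H x => ?_, fun H x hx => ?_⟩
    · obtain ⟨y, hy⟩ := H (Limits.cokernel.π (t p 1 0) ≫ x).hom
        (congrArg ModuleCat.Hom.hom (show t p 1 0 ≫ Limits.cokernel.π (t p 1 0) ≫ x = 0 by simp))
      refine ⟨ModuleCat.ofHom y, ?_⟩
      rw [← cancel_epi (Limits.cokernel.π _)]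
      refine Eq.trans ?_ (ModuleCat.hom_ext hy)
      rw [Limits.cokernel.π_desc_assoc]
      rfl
    · obtain ⟨y, hy⟩ := H (Limits.cokernel.desc (t p 1 0) (ModuleCat.ofHom x)
        (ModuleCat.hom_ext hx))
      refine ⟨y.hom, congrArg ModuleCat.Hom.hom (show t p 2 1 ≫ y = ModuleCat.ofHom x from ?_)⟩
      rw [← Limits.cokernel.π_desc (t p 1 0) (ModuleCat.ofHom x) (ModuleCat.hom_ext hx), ← hy]
      simp [h]
  rw [hh]
  exact nonempty_rightResolution (exists_preenvelope h) M

end Existence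

/-! ### Duality between tensor products and homomorphism modules -/

section HomDuality

/-- Both maps descend to B / ker g, which embeds in `C`; injectivity of `N` extends the descended
map. -/
lemma exists_comp_eq_of_ker_le {T : Type v} [Ring T] {B C N : Type u} [AddCommGroup B] [Module T B]
    [AddCommGroup C] [Module T C] [AddCommGroup N] [Module T N] [Module.Injective T N]
    (g : B →ₗ[T] C) (χ : B →ₗ[T] N) (h : ∀ x, g x = 0 → χ x = 0) :
    ∃ ψ : C →ₗ[T] N, ψ ∘ₗ g = χ := by
  obtain ⟨ψ, hψ⟩ := Module.Injective.out ((LinearMap.ker g).liftQ g le_rfl)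
    (LinearMap.ker_eq_bot.1 (Submodule.ker_liftQ_eq_bot _ _ _ le_rfl))
    ((LinearMap.ker g).liftQ χ h)
  exact ⟨ψ, LinearMap.ext fun x => hψ (Submodule.Quotient.mk x)⟩

/-- A natural isomorphism `Hom(W, X) ≅ Hom_T(F W, N)`. -/
structure HomDuality {C : Type*} [Category C] [Preadditive C] {T : Type v} [Ring T]
    (F : C ⥤ ModuleCat.{u} T) (X : C) (N : Type u) [AddCommGroup N] [Module T N] where
  equiv (W : C) : (W ⟶ X) ≃+ (F.obj W →ₗ[T] N)
  naturality {W W' : C} (f : W ⟶ W') (g : W' ⟶ X) :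
    equiv W (f ≫ g) = equiv W' g ∘ₗ (F.map f).hom

variable (R : Type u) [Ring R] (T : Type v) [Ring T]

/-- The adjunction isomorphism `Hom_R(L, Hom_T(M, N)) ≅ Hom_T(L ⊗_R M, N)`. -/
def tensorIntoDuality (M N : Type u) [AddCommGroup M] [Module R M] [Module T M]
    [SMulCommClass T R M] [AddCommGroup N] [Module T N] :
    HomDuality (tensorInto R T M) (homRight R T M N) N where
  equiv L :=
    { toFun := fun g =>
        let φ : L →+ (M →ₗ[T] N) := g.hom.toAddMonoidHom
        let ℓ : BTensor R L M →+ N := BTensor.lift (LinearMap.toAddMonoidHom'.comp φ)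
          fun l r m => DFunLike.congr_fun (F := M →ₗ[T] N) (map_smul g.hom (op r) l) m
        { toFun := ℓ
          map_add' := map_add ℓ
          map_smul' := fun t x => DFunLike.congr_fun
            (f := ℓ.comp (BTensor.map LinearMap.id (Module.toModuleEnd R (S := T) M t)))
            (g := (DistribSMul.toAddMonoidHom N t).comp ℓ)
            (BTensor.hom_ext fun l m => map_smul (φ l) t m) x }
      invFun := fun χ => ModuleCat.ofHom (Y := homRight R T M N)
        { toFun := fun l => show M →ₗ[T] N from
            { toFun := fun m => χ (btmul R l m)
              map_add' := fun m m' => (congrArg χ (btmul_add R l m m')).trans (map_add χ _ _)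
              map_smul' := fun t m => χ.map_smul t (btmul R l m) }
          map_add' := fun l l' => LinearMap.ext fun m =>
            (congrArg χ (add_btmul R l l' m)).trans (map_add χ _ _)
          map_smul' := fun r l => LinearMap.ext fun m =>
            congrArg χ (smul_btmul R r.unop l m) }
      left_inv := fun g => rfl
      right_inv := fun χ => LinearMap.ext fun x => by
        induction x using BTensor.induction with
        | h0 => exact (map_zero _).trans (map_zero _).symm
        | ht l m => rfl
        | ha x y hx hy =>
          exact (map_add _ _ _).trans ((congrArg₂ _ hx hy).trans (map_add _ _ _).symm)
      map_add' := fun g g' => LinearMap.ext fun x => by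
        induction x using BTensor.induction with
        | h0 => exact (map_zero _).trans (map_zero _).symm
        | ht l m => rfl
        | ha x y hx hy =>
          exact (map_add _ _ _).trans ((congrArg₂ _ hx hy).trans (map_add _ _ _).symm) }
  naturality f g := LinearMap.ext fun x => by
    induction x using BTensor.induction with
    | h0 => exact (map_zero _).trans (map_zero _).symm
    | ht l m => rfl
    | ha x y hx hy =>
      exact (map_add _ _ _).trans ((congrArg₂ _ hx hy).trans (map_add _ _ _).symm)

/-- The adjunction isomorphism `Hom_R(M, Hom_T(L, N)) ≅ Hom_T(L ⊗_R M, N)`. -/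
def tensorFromDuality (L N : Type u) [AddCommGroup L] [Module Rᵐᵒᵖ L] [Module T L]
    [SMulCommClass T Rᵐᵒᵖ L] [AddCommGroup N] [Module T N] :
    HomDuality (tensorFrom R T L) (homLeft R T L N) N where
  equiv M :=
    { toFun := fun g =>
        let φ : M →+ (L →ₗ[T] N) := g.hom.toAddMonoidHom
        -- Here `g` takes the second tensor factor first, hence the flip; its `R`-linearity is
        -- exactly the balance condition.
        let ℓ : BTensor R L M →+ N := BTensor.lift (LinearMap.toAddMonoidHom'.comp φ).flip
          fun l r m => (DFunLike.congr_fun (F := L →ₗ[T] N) (map_smul g.hom r m) l).symm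
        { toFun := ℓ
          map_add' := map_add ℓ
          map_smul' := fun t x => DFunLike.congr_fun
            (f := ℓ.comp (BTensor.map (Module.toModuleEnd Rᵐᵒᵖ (S := T) L t) LinearMap.id))
            (g := (DistribSMul.toAddMonoidHom N t).comp ℓ)
            (BTensor.hom_ext fun l m => map_smul (φ m) t l) x }
      invFun := fun χ => ModuleCat.ofHom (Y := homLeft R T L N)
        { toFun := fun m => show L →ₗ[T] N from
            { toFun := fun l => χ (btmul R l m)
              map_add' := fun l l' => (congrArg χ (add_btmul R l l' m)).trans (map_add χ _ _)
              map_smul' := fun t l => χ.map_smul t (btmul R l m) }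
          map_add' := fun m m' => LinearMap.ext fun l =>
            (congrArg χ (btmul_add R l m m')).trans (map_add χ _ _)
          map_smul' := fun r m => LinearMap.ext fun l =>
            congrArg χ (smul_btmul R r l m).symm }
      left_inv := fun g => rfl
      right_inv := fun χ => LinearMap.ext fun x => by
        induction x using BTensor.induction with
        | h0 => exact (map_zero _).trans (map_zero _).symm
        | ht l m => rfl
        | ha x y hx hy =>
          exact (map_add _ _ _).trans ((congrArg₂ _ hx hy).trans (map_add _ _ _).symm)
      map_add' := fun g g' => LinearMap.ext fun x => by
        induction x using BTensor.induction with
        | h0 => exact (map_zero _).trans (map_zero _).symm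
        | ht l m => rfl
        | ha x y hx hy =>
          exact (map_add _ _ _).trans ((congrArg₂ _ hx hy).trans (map_add _ _ _).symm) }
  naturality f g := LinearMap.ext fun x => by
    induction x using BTensor.induction with
    | h0 => exact (map_zero _).trans (map_zero _).symm
    | ht l m => rfl
    | ha x y hx hy =>
      exact (map_add _ _ _).trans ((congrArg₂ _ hx hy).trans (map_add _ _ _).symm)

end HomDuality

/-! ### The group `ℚ/ℤ` -/

section CharacterDual

/-- The group `ℚ/ℤ`, lifted to the universe `u`. -/
abbrev QModZ : Type u := ULift.{u} (AddCircle (1 : ℚ))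

/-- Divisible groups are injective by Baer's criterion. -/
instance : Module.Injective ℤ QModZ.{u} :=
  Module.ulift_injective_of_injective ℤ
    (Module.Baer.injective (Module.Baer.of_divisible (AddCircle (1 : ℚ))))

/-- If homomorphisms `B → ℚ/ℤ` killing the image of `f` factor through `g`, then the kernel of `g`
is contained in the image of `f`. -/
lemma exists_eq_of_forall_qModZ {A B C : Type*} [AddCommGroup A] [AddCommGroup B] [AddCommGroup C]
    [iA : Module ℤ A] [iB : Module ℤ B] [iC : Module ℤ C] (f : A →ₗ[ℤ] B) (g : B →ₗ[ℤ] C)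
    (H : ∀ χ : B →ₗ[ℤ] QModZ.{u}, χ ∘ₗ f = 0 → ∃ ψ : C →ₗ[ℤ] QModZ.{u}, ψ ∘ₗ g = χ)
    {x : B} (hx : g x = 0) : ∃ y, f y = x := by
  by_contra hxf
  obtain rfl : iA = AddCommGroup.toIntModule A := Subsingleton.elim _ _
  obtain rfl : iB = AddCommGroup.toIntModule B := Subsingleton.elim _ _
  -- If x were not in the image of f, a character of B / im f would separate its class from 0.
  -- Pulled back to B it factors through g, hence vanishes at x, a contradiction.
  have hne : QuotientAddGroup.mk' f.toAddMonoidHom.range x ≠ 0 := fun h =>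
    hxf ((QuotientAddGroup.eq_zero_iff x).1 h)
  obtain ⟨c, hc⟩ := CharacterModule.exists_character_apply_ne_zero_of_ne_zero hne
  let χ : B →ₗ[ℤ] QModZ.{u} := (AddEquiv.ulift.symm.toAddMonoidHom.comp
    (AddMonoidHom.comp c (QuotientAddGroup.mk' f.toAddMonoidHom.range))).toIntLinearMap
  obtain ⟨ψ, hψ⟩ := H χ (LinearMap.ext fun y => congrArg ULift.up
    ((congrArg c ((QuotientAddGroup.eq_zero_iff (f y)).2 ⟨y, rfl⟩)).trans (map_zero c)))
  refine hc (congrArg ULift.down ((LinearMap.congr_fun hψ x).symm.trans ?_ : χ x = 0))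
  rw [LinearMap.comp_apply, hx, map_zero]

end CharacterDual

/-! ### Duals of weak flat and weak injective modules -/

section Duals

variable {R : Type u} [Ring R]

/-- By adjunction a cocycle F₁ → W⁺ is a character of W ⊗ F₁ killing the image of W ⊗ F₂. Since Tor₁
vanishes, this image is the kernel of the map to W ⊗ F₀, and the character factors through that map.
-/
theorem isWeakInjective_homLeft {W : ModuleCat.{u} Rᵐᵒᵖ} (hW : IsWeakFlat (R := R) W) :
    IsWeakInjective (homLeft R ℤ W QModZ.{u}) := by
  rw [isWeakInjective_iff]
  intro p x hx
  let e := tensorFromDuality R ℤ W QModZ.{u}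
  obtain ⟨ψ, hψ⟩ := exists_comp_eq_of_ker_le
    ((tensorFrom R ℤ W).map (p.resolution.complex.d 1 0)).hom (e.equiv _ x) (fun z hz => by
      obtain ⟨y, rfl⟩ := (isWeakFlat_iff W).1 hW p z hz
      refine (LinearMap.congr_fun (e.naturality (p.resolution.complex.d 2 1) x) y).symm.trans ?_
      rw [hx, map_zero]
      rfl)
  refine ⟨(e.equiv _).symm ψ, (e.equiv _).injective ?_⟩
  rw [e.naturality, AddEquiv.apply_symm_apply, hψ]

/-! ### The evaluation map W⁺ ⊗ F → Hom(F, W)⁺. -/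

section Evaluation

variable {F F' : Type u} [AddCommGroup F] [Module R F] [AddCommGroup F'] [Module R F']
  {W : ModuleCat.{u} R} {D : Type u} [AddCommGroup D]

variable (F W D) in
/-- The canonical map `Hom_ℤ(W, D) ⊗_R F → Hom_ℤ(Hom_R(F, W), D)`. -/
def toDualHom : BTensor R (homRight R ℤ W D) F →+ ((F →ₗ[R] W) →ₗ[ℤ] D) :=
  BTensor.lift
    (AddMonoidHom.mk' (fun c => AddMonoidHom.mk'
      (fun x => ({ toFun := fun h => (show W →ₗ[ℤ] D from c) (h x)
                   map_add' := fun _ _ => map_add (show W →ₗ[ℤ] D from c) _ _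
                   map_smul' := fun _ _ => map_smul (show W →ₗ[ℤ] D from c) _ _ } :
                  (F →ₗ[R] W) →ₗ[ℤ] D))
      fun x y => LinearMap.ext fun h => (congrArg _ (map_add h x y)).trans
        (map_add (show W →ₗ[ℤ] D from c) _ _))
      fun _ _ => rfl)
    (fun c r x => LinearMap.ext fun h =>
      congrArg (show W →ₗ[ℤ] D from c) (map_smul h r x).symm)

lemma toDualHom_map (f : F →ₗ[R] F') (x : BTensor R (homRight R ℤ W D) F) :
    toDualHom F' W D (BTensor.map LinearMap.id f x) =
      toDualHom F W D x ∘ₗ LinearMap.lcomp ℤ W f := by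
  induction x using BTensor.induction with
  | h0 => simp
  | ht m n => rfl
  | ha x y hx hy => simp only [map_add, hx, hy, LinearMap.add_comp]

/-- Let s_k send w to the homomorphism c_k(·) w, where `b`, `c` is a dual basis. The inverse is θ ↦
∑ (θ ∘ s_k) ⊗ b_k. -/
lemma toDualHom_bijective [Module.Finite R F] [Module.Projective R F] :
    Function.Bijective (toDualHom F W D) := by
  obtain ⟨n, b, c, h⟩ := exists_dual_basis (R := R) F
  let s : Fin n → W →ₗ[ℤ] (F →ₗ[R] W) := fun k =>
    { toFun := fun w => (LinearMap.toSpanSingleton R W w) ∘ₗ c k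
      map_add' := fun w w' => by ext; simp
      map_smul' := fun t w => LinearMap.ext fun x => smul_comm (c k x) t w }
  let S : ((F →ₗ[R] W) →ₗ[ℤ] D) → BTensor R (homRight R ℤ W D) F := fun θ =>
    ∑ k, btmul R (M := homRight R ℤ W D) (θ ∘ₗ s k : W →ₗ[ℤ] D) (b k)
  have key : ∀ x, S (toDualHom F W D x) = x := by
    intro x
    induction x using BTensor.induction with
    | h0 =>
      refine Finset.sum_eq_zero fun k _ => ?_
      rw [map_zero, LinearMap.zero_comp]
      exact zero_btmul R _
    | ht m x =>
      refine Eq.trans ?_ (congrArg (btmul R m) (h x))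
      refine Eq.trans ?_ (map_sum (AddMonoidHom.mk' (btmul R m) (btmul_add R m)) _ _).symm
      exact Finset.sum_congr rfl fun k _ => smul_btmul R (c k x) m (b k)
    | ha x y hx hy =>
      refine Eq.trans ?_ (congrArg₂ _ hx hy)
      refine Eq.trans (Finset.sum_congr rfl fun k _ => ?_) Finset.sum_add_distrib
      rw [map_add, LinearMap.add_comp]
      exact add_btmul R (M := homRight R ℤ W D) _ _ _
  refine ⟨fun x y hxy => by rw [← key x, ← key y, hxy], fun θ => ⟨S θ, LinearMap.ext fun g => ?_⟩⟩
  have hg : ∑ k, s k (g (b k)) = g := by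
    refine LinearMap.ext fun x => ?_
    conv_rhs => rw [← h x]
    simp [s]
  conv_rhs => rw [← hg]
  rw [map_sum, map_sum]
  simp only [LinearMap.sum_apply]
  rfl

end Evaluation

/-- Adjunction does not apply in this direction; the evaluation isomorphism for finitely generated
projective modules replaces it and turns W⁺ ⊗ F into the dual of Hom(F, W), whose exactness is the
weak injectivity of `W`. -/
theorem isWeakFlat_homRight {W : ModuleCat.{u} R} (hW : IsWeakInjective W) :
    IsWeakFlat (homRight R ℤ W QModZ.{u}) := by
  rw [isWeakFlat_iff]
  intro p x hx
  obtain ⟨θ, hθ⟩ := exists_comp_eq_of_ker_le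
    (LinearMap.lcomp ℤ W (p.resolution.complex.d 2 1).hom) (toDualHom _ W QModZ.{u} x)
    (fun g hg => by
      obtain ⟨y, hy⟩ := (isWeakInjective_iff W).1 hW p (ModuleCat.ofHom g) (ModuleCat.hom_ext hg)
      obtain rfl : y.hom ∘ₗ (p.resolution.complex.d 1 0).hom = g :=
        congrArg ModuleCat.Hom.hom hy
      have := LinearMap.congr_fun (toDualHom_map (p.resolution.complex.d 1 0).hom x) y.hom
      rw [hx, map_zero] at this
      exact this.symm)
  obtain ⟨y, rfl⟩ := toDualHom_bijective.2 θ
  exact ⟨y, toDualHom_bijective.1 (by rw [toDualHom_map, hθ])⟩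

end Duals

/-! ### Homology groups as quotients -/

section Quotients

lemma nonempty_addEquiv_of_surjective {G A B : Type*} [AddGroup G] [AddGroup A] [AddGroup B]
    (p : G →+ A) (q : G →+ B) (hp : Function.Surjective p) (hq : Function.Surjective q)
    (h : ∀ x, p x = 0 ↔ q x = 0) : Nonempty (A ≃+ B) :=
  ⟨((QuotientAddGroup.quotientKerEquivOfSurjective p hp).symm.trans
    (QuotientAddGroup.quotientAddEquivOfEq (show p.ker = q.ker from AddSubgroup.ext h))).trans
    (QuotientAddGroup.quotientKerEquivOfSurjective q hq)⟩

/-- Homology is handled only through a surjection from the cycles whose kernel is the boundaries;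
isomorphisms then come from comparing kernels. -/
lemma exists_projection_moduleCat {T : Type v} [Ring T] (S : ShortComplex (ModuleCat.{u} T)) :
    ∃ π : LinearMap.ker S.g.hom →ₗ[T] S.homology, Function.Surjective π ∧
      ∀ z, π z = 0 ↔ ∃ x, S.f x = z := by
  let e : S.homology ≃ₗ[T] _ := S.moduleCatHomologyIso.toLinearEquiv
  refine ⟨e.symm.toLinearMap ∘ₗ Submodule.mkQ _,
    e.symm.surjective.comp (Submodule.mkQ_surjective _), fun z => ?_⟩
  refine (map_eq_zero_iff e.symm e.symm.injective).trans
    ((Submodule.Quotient.mk_eq_zero (LinearMap.range S.moduleCatToCycles)).trans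
      (exists_congr fun x => ?_))
  exact Subtype.ext_iff

lemma exists_projection_ab (S : ShortComplex AddCommGrpCat.{u}) :
    ∃ π : S.g.hom.ker →+ S.homology, Function.Surjective π ∧
      ∀ z, π z = 0 ↔ ∃ x, S.f x = z := by
  let e : S.homology ≃+ _ := S.abHomologyIso.addCommGroupIsoToAddEquiv
  refine ⟨e.symm.toAddMonoidHom.comp (QuotientAddGroup.mk' _),
    e.symm.surjective.comp (QuotientAddGroup.mk'_surjective _), fun z => ?_⟩
  refine (map_eq_zero_iff e.symm e.symm.injective).trans
    ((QuotientAddGroup.eq_zero_iff z).trans (exists_congr fun x => ?_))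
  exact Subtype.ext_iff

/-- The homology of a short complex, computed in a group into which its middle term embeds. -/
lemma nonempty_homology_addEquiv {T : Type v} [Ring T] (S : ShortComplex (ModuleCat.{u} T))
    {A : Type*} [AddCommGroup A] (Z B : AddSubgroup A) (a : S.X₂ →+ A)
    (ha : Function.Injective a) (hZ : ∀ z ∈ Z, ∃ x, a x = z) (hg : ∀ x, S.g x = 0 ↔ a x ∈ Z)
    (hB : ∀ b, b ∈ B ↔ ∃ x, a (S.f x) = b) :
    Nonempty (S.homology ≃+ Z ⧸ B.addSubgroupOf Z) := by
  obtain ⟨π, hπ, hker⟩ := exists_projection_moduleCat S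
  let b : LinearMap.ker S.g.hom →+ Z :=
    (a.comp (LinearMap.ker S.g.hom).subtype.toAddMonoidHom).codRestrict Z fun x => (hg _).1 x.2
  have hb : Function.Surjective b := by
    rintro ⟨z, hz⟩
    obtain ⟨x, rfl⟩ := hZ z hz
    exact ⟨⟨x, (hg x).2 hz⟩, rfl⟩
  refine nonempty_addEquiv_of_surjective π.toAddMonoidHom ((QuotientAddGroup.mk' _).comp b) hπ
    ((QuotientAddGroup.mk'_surjective _).comp hb) fun z => ?_
  refine (hker z).trans (Iff.trans ?_ (QuotientAddGroup.eq_zero_iff (b z)).symm)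
  refine Iff.trans ?_ (hB (a z)).symm
  exact exists_congr fun x => ha.eq_iff.symm

/-- Homology commutes with a duality into an injective module. -/
lemma nonempty_homology_dual_addEquiv {T : Type v} [Ring T] {N : Type u} [AddCommGroup N]
    [Module T N] [Module.Injective T N] (S : ShortComplex AddCommGrpCat.{u})
    (S' : ShortComplex (ModuleCat.{u} T)) (e₁ : S.X₁ ≃+ (S'.X₃ →ₗ[T] N))
    (e₂ : S.X₂ ≃+ (S'.X₂ →ₗ[T] N)) (e₃ : S.X₃ ≃+ (S'.X₁ →ₗ[T] N))
    (hf : ∀ x, e₂ (S.f x) = e₁ x ∘ₗ S'.g.hom) (hg : ∀ x, e₃ (S.g x) = e₂ x ∘ₗ S'.f.hom) :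
    Nonempty (S.homology ≃+ (S'.homology →ₗ[T] N)) := by
  obtain ⟨π, hπ, hker⟩ := exists_projection_ab S
  obtain ⟨π', hπ', hker'⟩ := exists_projection_moduleCat S'
  have hcyc : ∀ (z : S.g.hom.ker) (x), e₂ z (S'.f x) = 0 := fun z x => by
    have h := LinearMap.congr_fun (hg z) x
    rw [show S.g z = 0 from z.2, map_zero] at h
    exact h.symm
  -- The functional `e₂ z` kills boundaries, so its restriction to cycles descends to the homology
  -- of `S'`.
  have H : ∀ z : S.g.hom.ker, ∃ θ : S'.homology →ₗ[T] N, ∀ c, θ (π' c) = e₂ z c := fun z => by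
    have hle : LinearMap.ker π' ≤
        LinearMap.ker (e₂ z ∘ₗ (LinearMap.ker S'.g.hom).subtype) := fun c hc => by
      obtain ⟨x, hx⟩ := (hker' c).1 hc
      exact (congrArg (e₂ z) hx).symm.trans (hcyc z x)
    refine ⟨(LinearMap.ker π').liftQ _ hle ∘ₗ
      (π'.quotKerEquivOfSurjective hπ').symm.toLinearMap, fun c => ?_⟩
    have : (π'.quotKerEquivOfSurjective hπ').symm (π' c) = Submodule.Quotient.mk c :=
      (LinearEquiv.symm_apply_eq _).2 rfl
    rw [LinearMap.comp_apply, LinearEquiv.coe_coe, this]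
    rfl
  choose θ hθ using H
  let Θ : S.g.hom.ker →+ (S'.homology →ₗ[T] N) := AddMonoidHom.mk' θ fun z z' => by
    refine LinearMap.ext fun y => ?_
    obtain ⟨c, rfl⟩ := hπ' y
    rw [LinearMap.add_apply, hθ, hθ, hθ]
    exact LinearMap.congr_fun (map_add e₂ (z : S.X₂) z') _
  refine nonempty_addEquiv_of_surjective π Θ hπ (fun t => ?_) fun z => (hker z).trans ?_
  -- Surjectivity: injectivity of `N` extends a functional on cycles to the whole middle term, and
  -- the extension is a cocycle because `t ∘ₗ π'` kills boundaries.
  · obtain ⟨χ, hχ⟩ := Module.Injective.out (LinearMap.ker S'.g.hom).subtype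
      Subtype.val_injective (t ∘ₗ π')
    have hz : S.g (e₂.symm χ) = 0 := by
      refine e₃.injective ?_
      rw [hg, map_zero, AddEquiv.apply_symm_apply]
      refine LinearMap.ext fun x => ?_
      have h0 : π' ⟨S'.f x, S'.moduleCat_zero_apply x⟩ = 0 := (hker' _).2 ⟨x, rfl⟩
      exact (hχ ⟨S'.f x, S'.moduleCat_zero_apply x⟩).trans ((congrArg t h0).trans (map_zero t))
    refine ⟨⟨e₂.symm χ, hz⟩, LinearMap.ext fun y => ?_⟩
    obtain ⟨c, rfl⟩ := hπ' y
    refine (hθ _ c).trans ?_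
    rw [AddEquiv.apply_symm_apply]
    exact hχ c
  · constructor
    · rintro ⟨x, hx⟩
      refine LinearMap.ext fun y => ?_
      obtain ⟨c, rfl⟩ := hπ' y
      refine (hθ z c).trans ?_
      rw [← hx, hf]
      exact (congrArg (e₁ x) c.2).trans (map_zero _)
    · intro hz
      -- A zero functional on homology means that `e₂ z` vanishes on the kernel of `S'.g`, so it
      -- factors through `S'.g` and `z` is a boundary.
      obtain ⟨ψ, hψ⟩ := exists_comp_eq_of_ker_le S'.g.hom (e₂ z) fun c hc =>
        (hθ z ⟨c, hc⟩).symm.trans (LinearMap.congr_fun hz _)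
      refine ⟨e₁.symm ψ, e₂.injective ?_⟩
      rw [hf, AddEquiv.apply_symm_apply, hψ]

variable {C : Type*} [Category.{u} C] [Preadditive C] {T : Type v} [Ring T]
  {F : C ⥤ ModuleCat.{u} T} [F.Additive] {X : C} {N : Type u} [AddCommGroup N] [Module T N]

lemma HomDuality.nonempty_homology_addEquiv [Module.Injective T N] (D : HomDuality F X N)
    {ι : Type*} {c : ComplexShape ι} (K : HomologicalComplex C c) (i : ι) :
    Nonempty (((((preadditiveYoneda.obj X).mapHomologicalComplex _).obj K.op).homology i :
      AddCommGrpCat.{u}) ≃+ (((F.mapHomologicalComplex c).obj K).homology i →ₗ[T] N)) :=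
  nonempty_homology_dual_addEquiv
    ((((preadditiveYoneda.obj X).mapHomologicalComplex _).obj K.op).sc i)
    (((F.mapHomologicalComplex c).obj K).sc i) (D.equiv _) (D.equiv _) (D.equiv _)
    (fun x => D.naturality _ x) (fun x => D.naturality _ x)

end Quotients

/-! ### Comparison of resolutions -/

section Comparison

variable {C : Type*} [Category C] [Preadditive C] {𝒲 : ObjectProperty C} {M : C}

namespace RightResolution

/-- The usual comparison argument: the terms of `P'` lie in `𝒲`, and `P` is exact under morphisms
into `𝒲`, so each component extends from the previous one. -/
lemma exists_hom (P P' : RightResolution 𝒲 M) :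
    ∃ f : P.complex ⟶ P'.complex, P.ι ≫ f.f 0 = P'.ι := by
  choose zero hzero using P.exact_aug _ (P'.mem 0) P'.ι
  choose one hone using P.exact_zero _ (P'.mem 1) (zero ≫ P'.complex.d 0 1)
    (by rw [← Category.assoc, hzero, P'.ι_d])
  choose succ hsucc using fun n => P.exact_succ _ (P'.mem (n + 2)) n
  refine ⟨CochainComplex.mkHom _ _ zero one hone.symm fun n p =>
    ⟨succ n (p.2.1 ≫ P'.complex.d (n + 1) (n + 2)) ?_, (hsucc n _ _).symm⟩, hzero⟩
  rw [← Category.assoc, ← p.2.2, Category.assoc, HomologicalComplex.d_comp_d, Limits.comp_zero]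

lemma nonempty_homotopy (P P' : RightResolution 𝒲 M) (e : P.complex ⟶ P'.complex)
    (he : P.ι ≫ e.f 0 = 0) : Nonempty (Homotopy e 0) := by
  choose zero hzero using P.exact_zero _ (P'.mem 0) (e.f 0) he
  choose succ hsucc using fun n => P.exact_succ _ (P'.mem (n + 1)) n
  have h1 : P.complex.d 0 1 ≫ (e.f 1 - zero ≫ P'.complex.d 0 1) = 0 := by
    rw [Preadditive.comp_sub, ← Category.assoc, hzero, e.comm, sub_self]
  refine ⟨Homotopy.mkCoinductive e zero hzero.symm (succ 0 _ h1) (by rw [hsucc]; abel)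
    fun n p => ⟨succ (n + 1) (e.f (n + 2) - p.2.1 ≫ P'.complex.d (n + 1) (n + 2)) ?_, ?_⟩⟩
  · have hp : P.complex.d (n + 1) (n + 2) ≫ p.2.1 =
        e.f (n + 1) - p.1 ≫ P'.complex.d n (n + 1) := eq_sub_iff_add_eq'.2 p.2.2.symm
    rw [Preadditive.comp_sub, ← Category.assoc, hp, Preadditive.sub_comp, Category.assoc,
      HomologicalComplex.d_comp_d, Limits.comp_zero, sub_zero, e.comm, sub_self]
  · rw [hsucc]
    abel

/-- Any two right resolutions of an object are homotopy equivalent. -/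
theorem nonempty_homotopyEquiv (P P' : RightResolution 𝒲 M) :
    Nonempty (HomotopyEquiv P.complex P'.complex) := by
  obtain ⟨f, hf⟩ := exists_hom P P'
  obtain ⟨g, hg⟩ := exists_hom P' P
  obtain ⟨h⟩ := nonempty_homotopy P P (f ≫ g - 𝟙 _) (by
    rw [HomologicalComplex.sub_f_apply, Preadditive.comp_sub, HomologicalComplex.comp_f,
      ← Category.assoc, hf, hg, HomologicalComplex.id_f, Category.comp_id, sub_self])
  obtain ⟨h'⟩ := nonempty_homotopy P' P' (g ≫ f - 𝟙 _) (by
    rw [HomologicalComplex.sub_f_apply, Preadditive.comp_sub, HomologicalComplex.comp_f,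
      ← Category.assoc, hg, hf, HomologicalComplex.id_f, Category.comp_id, sub_self])
  exact ⟨⟨f, g, Homotopy.equivSubZero.symm h, Homotopy.equivSubZero.symm h'⟩⟩

end RightResolution

end Comparison

/-! ### Balance -/

section DoubleComplex

variable {C : ℕ → ℕ → Type u} [∀ i j, AddCommGroup (C i j)]
  (d₁ : ∀ i j, C i j →+ C (i + 1) j) (d₂ : ∀ i j, C i j →+ C i (j + 1))

/-- The elements annihilated by both differentials. -/
def biCycles (i j : ℕ) : AddSubgroup (C i j) := (d₁ i j).ker ⊓ (d₂ i j).ker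

/-- The image under the second differential of the kernel of the first one. -/
def biBoundaries₂ (i j : ℕ) : AddSubgroup (C i (j + 1)) := (d₁ i j).ker.map (d₂ i j)

/-- The image under the first differential of the kernel of the second one. -/
def biBoundaries₁ (i j : ℕ) : AddSubgroup (C (i + 1) j) := (d₂ i j).ker.map (d₁ i j)

variable (comm : ∀ i j x, d₁ i (j + 1) (d₂ i j x) = d₂ (i + 1) j (d₁ i j x))
  (h₁ : ∀ i j x, d₁ (i + 1) j x = 0 ↔ ∃ y, d₁ i j y = x)
  (h₂ : ∀ i j x, d₂ i (j + 1) x = 0 ↔ ∃ y, d₂ i j y = x)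

include comm h₁ h₂

/-- By exactness both sides are the image of the composite of the two differentials on `C i j`. -/
lemma biBoundaries_eq (i j : ℕ) : biBoundaries₂ d₁ d₂ (i + 1) j = biBoundaries₁ d₁ d₂ i (j + 1) := by
  ext x
  constructor
  · rintro ⟨a, ha, rfl⟩
    obtain ⟨b, rfl⟩ := (h₁ i j a).1 ha
    exact ⟨d₂ i j b, (h₂ i j _).2 ⟨b, rfl⟩, comm i j b⟩
  · rintro ⟨a, ha, rfl⟩
    obtain ⟨b, rfl⟩ := (h₂ i j a).1 ha
    exact ⟨d₁ i j b, (h₁ i j _).2 ⟨b, rfl⟩, (comm i j b).symm⟩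

/-- Let E be the kernel of `d₁` after `d₂` on `C i j`. Both groups are the quotient of E by ker d₁ +
ker d₂, through `d₂` on one side and `d₁` on the other. -/
lemma nonempty_biCycles_addEquiv_step (i j : ℕ) :
    Nonempty ((biCycles d₁ d₂ i (j + 1) ⧸
        (biBoundaries₂ d₁ d₂ i j).addSubgroupOf (biCycles d₁ d₂ i (j + 1))) ≃+
      (biCycles d₁ d₂ (i + 1) j ⧸
        (biBoundaries₁ d₁ d₂ i j).addSubgroupOf (biCycles d₁ d₂ (i + 1) j))) := by
  let E : AddSubgroup (C i j) := ((d₁ i (j + 1)).comp (d₂ i j)).ker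
  let p : E →+ biCycles d₁ d₂ i (j + 1) := ((d₂ i j).comp E.subtype).codRestrict _ fun y =>
    ⟨y.2, (h₂ i j _).2 ⟨y, rfl⟩⟩
  let q : E →+ biCycles d₁ d₂ (i + 1) j := ((d₁ i j).comp E.subtype).codRestrict _ fun y =>
    ⟨(h₁ i j _).2 ⟨y, rfl⟩, (comm i j y).symm.trans y.2⟩
  have hp : Function.Surjective p := by
    rintro ⟨x, hx₁, hx₂⟩
    obtain ⟨y, rfl⟩ := (h₂ i j x).1 hx₂
    exact ⟨⟨y, hx₁⟩, rfl⟩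
  have hq : Function.Surjective q := by
    rintro ⟨x, hx₁, hx₂⟩
    obtain ⟨y, rfl⟩ := (h₁ i j x).1 hx₁
    exact ⟨⟨y, (comm i j y).trans hx₂⟩, rfl⟩
  refine nonempty_addEquiv_of_surjective ((QuotientAddGroup.mk' _).comp p)
    ((QuotientAddGroup.mk' _).comp q) ((QuotientAddGroup.mk'_surjective _).comp hp)
    ((QuotientAddGroup.mk'_surjective _).comp hq) fun y =>
      (QuotientAddGroup.eq_zero_iff (p y)).trans
        (Iff.trans ?_ (QuotientAddGroup.eq_zero_iff (q y)).symm)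
  constructor
  · rintro ⟨a, ha, hay⟩
    refine ⟨y - a, ?_, ?_⟩
    · exact (map_sub (d₂ i j) _ _).trans (sub_eq_zero.2 hay.symm)
    · exact (map_sub (d₁ i j) _ _).trans ((congrArg _ ha).trans (sub_zero _))
  · rintro ⟨a, ha, hay⟩
    refine ⟨y - a, ?_, ?_⟩
    · exact (map_sub (d₁ i j) _ _).trans (sub_eq_zero.2 hay.symm)
    · exact (map_sub (d₂ i j) _ _).trans ((congrArg _ ha).trans (sub_zero _))

/-- Steps move along an antidiagonal from `(i, j + 1)` to `(n + 1, 0)`; `biBoundaries_eq` matches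
the denominators of consecutive steps. -/
lemma nonempty_biCycles_addEquiv (j : ℕ) : ∀ i n, i + j = n →
    Nonempty ((biCycles d₁ d₂ i (j + 1) ⧸
        (biBoundaries₂ d₁ d₂ i j).addSubgroupOf (biCycles d₁ d₂ i (j + 1))) ≃+
      (biCycles d₁ d₂ (n + 1) 0 ⧸
        (biBoundaries₁ d₁ d₂ n 0).addSubgroupOf (biCycles d₁ d₂ (n + 1) 0))) := by
  induction j with
  | zero =>
    rintro i _ rfl
    exact nonempty_biCycles_addEquiv_step d₁ d₂ comm h₁ h₂ i 0
  | succ j ih =>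
    intro i n hn
    obtain ⟨e⟩ := nonempty_biCycles_addEquiv_step d₁ d₂ comm h₁ h₂ i (j + 1)
    rw [← biBoundaries_eq d₁ d₂ comm h₁ h₂ i j] at e
    obtain ⟨e'⟩ := ih (i + 1) n (by omega)
    exact ⟨e.trans e'⟩

end DoubleComplex

/-! ### Exactness of the augmented double complex P ⊗ Q and the cohomology of its edges. -/

section TensorExact

section Generic

variable {C : Type*} [Category C] [Preadditive C] {F : C ⥤ ModuleCat.{u} ℤ} {X : C}
  {𝒲 : ObjectProperty C} {M : C}

/-- Characters of `F.obj B` are morphisms `B ⟶ X`, so exactness under morphisms into this one `X`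
yields exactness after `F`. -/
lemma HomDuality.exists_eq_of_map_eq_zero (D : HomDuality F X QModZ.{u}) {A B B' : C} (f : A ⟶ B)
    (g : B ⟶ B') (H : ∀ k : B ⟶ X, f ≫ k = 0 → ∃ l, g ≫ l = k) {x : F.obj B}
    (hx : F.map g x = 0) : ∃ y, F.map f y = x := by
  refine exists_eq_of_forall_qModZ (F.map f).hom (F.map g).hom (fun χ hχ => ?_) hx
  obtain ⟨k, rfl⟩ := (D.equiv _).surjective χ
  obtain ⟨l, hl⟩ := H k ((D.equiv _).injective (by rw [D.naturality, hχ, map_zero]))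
  exact ⟨D.equiv _ l, by rw [← D.naturality, hl]⟩

lemma HomDuality.map_ι_injective [F.Additive] (D : HomDuality F X QModZ.{u}) (hX : 𝒲 X)
    (P : RightResolution 𝒲 M) : Function.Injective (F.map P.ι) := by
  refine (injective_iff_map_eq_zero (F.map P.ι).hom).2 fun x hx => ?_
  -- With zero as the incoming map, exactness says that the kernel is zero.
  obtain ⟨y, hy⟩ := D.exists_eq_of_map_eq_zero (0 : M ⟶ M) P.ι
    (fun k _ => P.exact_aug X hX k) hx
  rw [← hy, F.map_zero]
  rfl

lemma HomDuality.map_d_zero_eq_zero_iff [F.Additive] (D : HomDuality F X QModZ.{u}) (hX : 𝒲 X)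
    (P : RightResolution 𝒲 M) (x : F.obj (P.complex.X 0)) :
    F.map (P.complex.d 0 1) x = 0 ↔ ∃ y, F.map P.ι y = x := by
  refine ⟨D.exists_eq_of_map_eq_zero _ _ (P.exact_zero X hX), ?_⟩
  rintro ⟨y, rfl⟩
  have h : F.map P.ι ≫ F.map (P.complex.d 0 1) = 0 := by
    rw [← F.map_comp, P.ι_d, F.map_zero]
  exact ConcreteCategory.congr_hom h y

lemma HomDuality.map_d_succ_eq_zero_iff [F.Additive] (D : HomDuality F X QModZ.{u}) (hX : 𝒲 X)
    (P : RightResolution 𝒲 M) (i : ℕ) (x : F.obj (P.complex.X (i + 1))) :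
    F.map (P.complex.d (i + 1) (i + 2)) x = 0 ↔ ∃ y, F.map (P.complex.d i (i + 1)) y = x := by
  refine ⟨D.exists_eq_of_map_eq_zero _ _ (P.exact_succ X hX i), ?_⟩
  rintro ⟨y, rfl⟩
  have h : F.map (P.complex.d i (i + 1)) ≫ F.map (P.complex.d (i + 1) (i + 2)) = 0 := by
    rw [← F.map_comp, HomologicalComplex.d_comp_d, F.map_zero]
  exact ConcreteCategory.congr_hom h y

end Generic

variable {R : Type u} [Ring R] {M : ModuleCat.{u} Rᵐᵒᵖ} {N : ModuleCat.{u} R}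
  (P : RightResolution (IsWeakFlat (R := R)) M) (Q : RightResolution (IsWeakInjective (R := R)) N)

/-- The differential of `P ⊗ Q` in the direction of `P`. -/
def tensorD₁ (i j : ℕ) : BTensor R (P.complex.X i) (Q.complex.X j) →+
    BTensor R (P.complex.X (i + 1)) (Q.complex.X j) :=
  BTensor.map (P.complex.d i (i + 1)).hom LinearMap.id

/-- The differential of `P ⊗ Q` in the direction of `Q`. -/
def tensorD₂ (i j : ℕ) : BTensor R (P.complex.X i) (Q.complex.X j) →+
    BTensor R (P.complex.X i) (Q.complex.X (j + 1)) :=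
  BTensor.map LinearMap.id (Q.complex.d j (j + 1)).hom

lemma BTensor.map_comm {A A' : ModuleCat.{u} Rᵐᵒᵖ} {B B' : ModuleCat.{u} R} (f : A →ₗ[Rᵐᵒᵖ] A')
    (g : B →ₗ[R] B') (x : BTensor R A B) :
    BTensor.map f LinearMap.id (BTensor.map LinearMap.id g x) =
      BTensor.map LinearMap.id g (BTensor.map f LinearMap.id x) := by
  rw [← BTensor.map_comp, ← BTensor.map_comp]
  rfl

lemma tensorD_comm (i j : ℕ) (x : BTensor R (P.complex.X i) (Q.complex.X j)) :
    tensorD₁ P Q i (j + 1) (tensorD₂ P Q i j x) = tensorD₂ P Q (i + 1) j (tensorD₁ P Q i j x) :=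
  BTensor.map_comm _ _ x

/-- The dual of the weak injective module Q^j is weak flat, so `P` is exact under morphisms into it.
-/
lemma tensorD₁_eq_zero_iff (i j : ℕ) (x : BTensor R (P.complex.X (i + 1)) (Q.complex.X j)) :
    tensorD₁ P Q (i + 1) j x = 0 ↔ ∃ y, tensorD₁ P Q i j y = x :=
  (tensorIntoDuality R ℤ (Q.complex.X j) QModZ.{u}).map_d_succ_eq_zero_iff
    (isWeakFlat_homRight (Q.mem j)) P i x

lemma tensorD₂_eq_zero_iff (i j : ℕ) (x : BTensor R (P.complex.X i) (Q.complex.X (j + 1))) :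
    tensorD₂ P Q i (j + 1) x = 0 ↔ ∃ y, tensorD₂ P Q i j y = x :=
  (tensorFromDuality R ℤ (P.complex.X i) QModZ.{u}).map_d_succ_eq_zero_iff
    (isWeakInjective_homLeft (P.mem i)) Q j x

/-- The augmentation `M ⊗ Q → P⁰ ⊗ Q`. -/
def tensorι₁ (j : ℕ) : BTensor R M (Q.complex.X j) →+ BTensor R (P.complex.X 0) (Q.complex.X j) :=
  BTensor.map P.ι.hom LinearMap.id

/-- The augmentation `P ⊗ N → P ⊗ Q⁰`. -/
def tensorι₂ (i : ℕ) : BTensor R (P.complex.X i) N →+ BTensor R (P.complex.X i) (Q.complex.X 0) :=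
  BTensor.map LinearMap.id Q.ι.hom

lemma tensorι₁_injective (j : ℕ) : Function.Injective (tensorι₁ P Q j) :=
  (tensorIntoDuality R ℤ (Q.complex.X j) QModZ.{u}).map_ι_injective
    (isWeakFlat_homRight (Q.mem j)) P

lemma tensorι₂_injective (i : ℕ) : Function.Injective (tensorι₂ P Q i) :=
  (tensorFromDuality R ℤ (P.complex.X i) QModZ.{u}).map_ι_injective
    (isWeakInjective_homLeft (P.mem i)) Q

lemma tensorD₁_zero_eq_zero_iff (j : ℕ) (x : BTensor R (P.complex.X 0) (Q.complex.X j)) :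
    tensorD₁ P Q 0 j x = 0 ↔ ∃ y, tensorι₁ P Q j y = x :=
  (tensorIntoDuality R ℤ (Q.complex.X j) QModZ.{u}).map_d_zero_eq_zero_iff
    (isWeakFlat_homRight (Q.mem j)) P x

lemma tensorD₂_zero_eq_zero_iff (i : ℕ) (x : BTensor R (P.complex.X i) (Q.complex.X 0)) :
    tensorD₂ P Q i 0 x = 0 ↔ ∃ y, tensorι₂ P Q i y = x :=
  (tensorFromDuality R ℤ (P.complex.X i) QModZ.{u}).map_d_zero_eq_zero_iff
    (isWeakInjective_homLeft (P.mem i)) Q x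

lemma mem_biCycles_tensorι₁ (j : ℕ) (x : BTensor R M (Q.complex.X j)) :
    BTensor.map LinearMap.id (Q.complex.d j (j + 1)).hom x = 0 ↔
      tensorι₁ P Q j x ∈ biCycles (tensorD₁ P Q) (tensorD₂ P Q) 0 j := by
  have h : tensorι₁ P Q (j + 1) (BTensor.map LinearMap.id (Q.complex.d j (j + 1)).hom x) =
    tensorD₂ P Q 0 j (tensorι₁ P Q j x) := BTensor.map_comm _ _ x
  rw [← map_eq_zero_iff _ (tensorι₁_injective P Q (j + 1)), h]
  exact ⟨fun hx => ⟨(tensorD₁_zero_eq_zero_iff P Q j _).2 ⟨x, rfl⟩, hx⟩, fun hx => hx.2⟩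

lemma mem_biCycles_tensorι₂ (i : ℕ) (x : BTensor R (P.complex.X i) N) :
    BTensor.map (P.complex.d i (i + 1)).hom LinearMap.id x = 0 ↔
      tensorι₂ P Q i x ∈ biCycles (tensorD₁ P Q) (tensorD₂ P Q) i 0 := by
  have h : tensorι₂ P Q (i + 1) (BTensor.map (P.complex.d i (i + 1)).hom LinearMap.id x) =
    tensorD₁ P Q i 0 (tensorι₂ P Q i x) := (BTensor.map_comm _ _ x).symm
  rw [← map_eq_zero_iff _ (tensorι₂_injective P Q (i + 1)), h]
  exact ⟨fun hx => ⟨hx, (tensorD₂_zero_eq_zero_iff P Q i _).2 ⟨x, rfl⟩⟩, fun hx => hx.1⟩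

lemma nonempty_relTorInj_zero_addEquiv :
    Nonempty (relTorInj Q ℤ M 0 ≃+ biCycles (tensorD₁ P Q) (tensorD₂ P Q) 0 0 ⧸
      (⊥ : AddSubgroup _).addSubgroupOf (biCycles (tensorD₁ P Q) (tensorD₂ P Q) 0 0)) := by
  let K := ((tensorFrom R ℤ M).mapHomologicalComplex (ComplexShape.up ℕ)).obj Q.complex
  -- Degree 0 has no predecessor and serves as its own; the incoming map is then the zero map `K.d 0
  -- 0`.
  obtain ⟨e⟩ := nonempty_homology_addEquiv (K.sc' 0 0 1)
    (biCycles (tensorD₁ P Q) (tensorD₂ P Q) 0 0) ⊥ (tensorι₁ P Q 0)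
    (tensorι₁_injective P Q 0) (fun z hz => (tensorD₁_zero_eq_zero_iff P Q 0 z).1 hz.1)
    (mem_biCycles_tensorι₁ P Q 0) fun b => by
      have hf : ∀ x, tensorι₁ P Q 0 ((K.sc' 0 0 1).f x) = 0 := fun x => by
        rw [show (K.sc' 0 0 1).f = 0 from K.shape 0 0 (by simp)]
        exact map_zero _
      exact ⟨fun h => ⟨0, (hf 0).trans (AddSubgroup.mem_bot.1 h).symm⟩,
        fun ⟨x, h⟩ => AddSubgroup.mem_bot.2 (h.symm.trans (hf x))⟩
  exact ⟨(K.homologyIsoSc' 0 0 1 (by simp) (by simp)).toLinearEquiv.toAddEquiv.trans e⟩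

lemma nonempty_relTorFlat_zero_addEquiv :
    Nonempty (relTorFlat P ℤ N 0 ≃+ biCycles (tensorD₁ P Q) (tensorD₂ P Q) 0 0 ⧸
      (⊥ : AddSubgroup _).addSubgroupOf (biCycles (tensorD₁ P Q) (tensorD₂ P Q) 0 0)) := by
  let K := ((tensorInto R ℤ N).mapHomologicalComplex (ComplexShape.up ℕ)).obj P.complex
  obtain ⟨e⟩ := nonempty_homology_addEquiv (K.sc' 0 0 1)
    (biCycles (tensorD₁ P Q) (tensorD₂ P Q) 0 0) ⊥ (tensorι₂ P Q 0)
    (tensorι₂_injective P Q 0) (fun z hz => (tensorD₂_zero_eq_zero_iff P Q 0 z).1 hz.2)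
    (mem_biCycles_tensorι₂ P Q 0) fun b => by
      have hf : ∀ x, tensorι₂ P Q 0 ((K.sc' 0 0 1).f x) = 0 := fun x => by
        rw [show (K.sc' 0 0 1).f = 0 from K.shape 0 0 (by simp)]
        exact map_zero _
      exact ⟨fun h => ⟨0, (hf 0).trans (AddSubgroup.mem_bot.1 h).symm⟩,
        fun ⟨x, h⟩ => AddSubgroup.mem_bot.2 (h.symm.trans (hf x))⟩
  exact ⟨(K.homologyIsoSc' 0 0 1 (by simp) (by simp)).toLinearEquiv.toAddEquiv.trans e⟩

/-- The augmentation embeds M ⊗ Q in P⁰ ⊗ Q as the kernel of `tensorD₁`. Its cycles become the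
elements killed by both differentials, its boundaries the group `biBoundaries₂`. -/
lemma nonempty_relTorInj_succ_addEquiv (n : ℕ) :
    Nonempty (relTorInj Q ℤ M (n + 1) ≃+ biCycles (tensorD₁ P Q) (tensorD₂ P Q) 0 (n + 1) ⧸
      (biBoundaries₂ (tensorD₁ P Q) (tensorD₂ P Q) 0 n).addSubgroupOf
        (biCycles (tensorD₁ P Q) (tensorD₂ P Q) 0 (n + 1))) := by
  let K := ((tensorFrom R ℤ M).mapHomologicalComplex (ComplexShape.up ℕ)).obj Q.complex
  obtain ⟨e⟩ := nonempty_homology_addEquiv (K.sc' n (n + 1) (n + 2))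
    (biCycles (tensorD₁ P Q) (tensorD₂ P Q) 0 (n + 1))
    (biBoundaries₂ (tensorD₁ P Q) (tensorD₂ P Q) 0 n) (tensorι₁ P Q (n + 1))
    (tensorι₁_injective P Q (n + 1))
    (fun z hz => (tensorD₁_zero_eq_zero_iff P Q (n + 1) z).1 hz.1)
    (mem_biCycles_tensorι₁ P Q (n + 1)) fun b => by
      constructor
      · rintro ⟨a, ha, rfl⟩
        obtain ⟨x, rfl⟩ := (tensorD₁_zero_eq_zero_iff P Q n a).1 ha
        exact ⟨x, BTensor.map_comm _ _ x⟩
      · rintro ⟨x, rfl⟩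
        exact ⟨tensorι₁ P Q n x, (tensorD₁_zero_eq_zero_iff P Q n _).2 ⟨x, rfl⟩,
          (BTensor.map_comm _ _ x).symm⟩
  exact ⟨(K.homologyIsoSc' n (n + 1) (n + 2) (by simp) (by simp)).toLinearEquiv.toAddEquiv.trans e⟩

lemma nonempty_relTorFlat_succ_addEquiv (n : ℕ) :
    Nonempty (relTorFlat P ℤ N (n + 1) ≃+ biCycles (tensorD₁ P Q) (tensorD₂ P Q) (n + 1) 0 ⧸
      (biBoundaries₁ (tensorD₁ P Q) (tensorD₂ P Q) n 0).addSubgroupOf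
        (biCycles (tensorD₁ P Q) (tensorD₂ P Q) (n + 1) 0)) := by
  let K := ((tensorInto R ℤ N).mapHomologicalComplex (ComplexShape.up ℕ)).obj P.complex
  obtain ⟨e⟩ := nonempty_homology_addEquiv (K.sc' n (n + 1) (n + 2))
    (biCycles (tensorD₁ P Q) (tensorD₂ P Q) (n + 1) 0)
    (biBoundaries₁ (tensorD₁ P Q) (tensorD₂ P Q) n 0) (tensorι₂ P Q (n + 1))
    (tensorι₂_injective P Q (n + 1))
    (fun z hz => (tensorD₂_zero_eq_zero_iff P Q (n + 1) z).1 hz.2)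
    (mem_biCycles_tensorι₂ P Q (n + 1)) fun b => by
      constructor
      · rintro ⟨a, ha, rfl⟩
        obtain ⟨x, rfl⟩ := (tensorD₂_zero_eq_zero_iff P Q n a).1 ha
        exact ⟨x, (BTensor.map_comm _ _ x).symm⟩
      · rintro ⟨x, rfl⟩
        exact ⟨tensorι₂ P Q n x, (tensorD₂_zero_eq_zero_iff P Q n _).2 ⟨x, rfl⟩,
          BTensor.map_comm _ _ x⟩
  exact ⟨(K.homologyIsoSc' n (n + 1) (n + 2) (by simp) (by simp)).toLinearEquiv.toAddEquiv.trans e⟩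

/-- `Tor^n_𝒲(M, N)` may be computed with a resolution of either variable. -/
theorem nonempty_relTorFlat_addEquiv_relTorInj (n : ℕ) :
    Nonempty (relTorFlat P ℤ N n ≃+ relTorInj Q ℤ M n) := by
  cases n with
  | zero =>
    obtain ⟨e⟩ := nonempty_relTorFlat_zero_addEquiv P Q
    obtain ⟨e'⟩ := nonempty_relTorInj_zero_addEquiv P Q
    exact ⟨e.trans e'.symm⟩
  | succ n =>
    obtain ⟨e⟩ := nonempty_relTorFlat_succ_addEquiv P Q n
    obtain ⟨e'⟩ := nonempty_relTorInj_succ_addEquiv P Q n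
    obtain ⟨e''⟩ := nonempty_biCycles_addEquiv (tensorD₁ P Q) (tensorD₂ P Q) (tensorD_comm P Q)
      (tensorD₁_eq_zero_iff P Q) (tensorD₂_eq_zero_iff P Q) n 0 n (zero_add n)
    exact ⟨e.trans (e''.symm.trans e'.symm)⟩

end TensorExact

/-! ### The duality isomorphisms -/

section Main

variable {C : Type*} [Category.{u} C] [Preadditive C] {T : Type v} [Ring T]
  {F : C ⥤ ModuleCat.{u} T} [F.Additive] {X : C} {N : Type u} [AddCommGroup N] [Module T N]
  {𝒲 : ObjectProperty C} {M : C}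

/-- Duality is applied to `P` alone; a homotopy equivalence, carried through the additive functor
`F`, then replaces `P` by `P'` on the Tor side. -/
theorem HomDuality.nonempty_relExt_addEquiv [Module.Injective T N] (D : HomDuality F X N)
    (P P' : RightResolution 𝒲 M) (n : ℕ) :
    Nonempty (relExt P X n ≃+
      (((F.mapHomologicalComplex _).obj P'.complex).homology n →ₗ[T] N)) := by
  obtain ⟨e⟩ := D.nonempty_homology_addEquiv P.complex n
  obtain ⟨h⟩ := P.nonempty_homotopyEquiv P'
  exact ⟨e.trans (((F.mapHomotopyEquiv h).toHomologyIso n).toLinearEquiv.congrLeft N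
    ℤ).toAddEquiv⟩

/-- The relative `Ext` groups with values in isomorphic objects agree. -/
lemma nonempty_relExt_addEquiv_of_iso (P : RightResolution 𝒲 M) {X X' : C} (e : X ≅ X') (n : ℕ) :
    Nonempty (relExt P X n ≃+ relExt P X' n) :=
  ⟨((HomologicalComplex.homologyFunctor _ _ n).mapIso
    ((NatIso.mapHomologicalComplex (preadditiveYoneda.mapIso e) _).app
      P.complex.op)).addCommGroupIsoToAddEquiv⟩

/-- `ℤ`-linear maps to the lifted `ℚ/ℤ` are characters. -/
noncomputable def homQModZEquiv (A : Type*) [AddCommGroup A] [iA : Module ℤ A] :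
    (A →ₗ[ℤ] QModZ.{u}) ≃+ CharacterModule A where
  toFun f := AddEquiv.ulift.toAddMonoidHom.comp f.toAddMonoidHom
  invFun c :=
    { toFun := fun a => ULift.up (c a)
      map_add' := fun a b => congrArg ULift.up (map_add c a b)
      map_smul' := fun t a => by
        obtain rfl : iA = AddCommGroup.toIntModule A := Subsingleton.elim _ _
        exact congrArg ULift.up (map_zsmul c t a) }
  left_inv _ := rfl
  right_inv _ := rfl
  map_add' _ _ := rfl

variable (R : Type u) [Ring R]

/-- The character module of a left module as a homomorphism module. -/
noncomputable def homRightIsoCharRight (N : ModuleCat.{u} R) :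
    homRight R ℤ N QModZ.{u} ≅ charRight R N :=
  (show homRight R ℤ N QModZ.{u} ≃ₗ[_] charRight R N from
    { toFun := homQModZEquiv N
      invFun := (homQModZEquiv N).symm
      left_inv := fun _ => rfl
      right_inv := fun _ => rfl
      map_add' := fun _ _ => rfl
      map_smul' := fun _ _ => rfl }).toModuleIso

/-- The character module of a right module as a homomorphism module. -/
noncomputable def homLeftIsoCharLeft (M : ModuleCat.{u} Rᵐᵒᵖ) :
    homLeft R ℤ M QModZ.{u} ≅ charLeft R M :=
  (show homLeft R ℤ M QModZ.{u} ≃ₗ[_] charLeft R M from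
    { toFun := homQModZEquiv M
      invFun := (homQModZEquiv M).symm
      left_inv := fun _ => rfl
      right_inv := fun _ => rfl
      map_add' := fun _ _ => rfl
      map_smul' := fun _ _ => rfl }).toModuleIso

end Main

end WeakDerived

theorem mainTheorem9 (R : Type u) [Ring R] (S : Type v) [Ring S] :
    -- every right (left) module has a right weak flat (weak injective) resolution
    (∀ L : ModuleCat.{u} Rᵐᵒᵖ,
      Nonempty (WeakDerived.RightResolution WeakDerived.IsWeakFlat L)) ∧
    (∀ M : ModuleCat.{u} R,
      Nonempty (WeakDerived.RightResolution WeakDerived.IsWeakInjective M)) ∧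
    -- (1) for whichever resolutions of `L` are used on the two sides
    (∀ (L : ModuleCat.{u} Rᵐᵒᵖ)
      (M : Type u) [AddCommGroup M] [Module R M] [Module Sᵐᵒᵖ M] [SMulCommClass Sᵐᵒᵖ R M]
      (N : Type u) [AddCommGroup N] [Module Sᵐᵒᵖ N] [Module.Injective Sᵐᵒᵖ N]
      (P P' : WeakDerived.RightResolution WeakDerived.IsWeakFlat L) (n : ℕ),
      Nonempty (WeakDerived.relExt P (WeakDerived.homRight R Sᵐᵒᵖ M N) n ≃+
        (WeakDerived.relTorFlat P' Sᵐᵒᵖ M n →ₗ[Sᵐᵒᵖ] N))) ∧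
    -- (2) for whichever resolutions of `M` are used on the two sides
    (∀ (L : Type u) [AddCommGroup L] [Module S L] [Module Rᵐᵒᵖ L] [SMulCommClass S Rᵐᵒᵖ L]
      (M : ModuleCat.{u} R)
      (N : Type u) [AddCommGroup N] [Module S N] [Module.Injective S N]
      (Q Q' : WeakDerived.RightResolution WeakDerived.IsWeakInjective M) (n : ℕ),
      Nonempty (WeakDerived.relExt Q (WeakDerived.homLeft R S L N) n ≃+
        (WeakDerived.relTorInj Q' S L n →ₗ[S] N))) ∧
    -- the corollary, with `Tor` computed in either variable
    (∀ (M : ModuleCat.{u} Rᵐᵒᵖ) (N : ModuleCat.{u} R)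
      (P P' : WeakDerived.RightResolution WeakDerived.IsWeakFlat M)
      (Q Q' : WeakDerived.RightResolution WeakDerived.IsWeakInjective N) (n : ℕ),
      Nonempty (WeakDerived.relExt P (WeakDerived.charRight R N) n ≃+
        CharacterModule (WeakDerived.relTorFlat P' ℤ N n)) ∧
      Nonempty (WeakDerived.relTorFlat P' ℤ N n ≃+ WeakDerived.relTorInj Q' ℤ M n) ∧
      Nonempty (CharacterModule (WeakDerived.relTorInj Q' ℤ M n) ≃+
        WeakDerived.relExt Q (WeakDerived.charLeft R M) n)) := by
  refine ⟨WeakDerived.nonempty_weakFlat_resolution, WeakDerived.nonempty_weakInjective_resolution,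
    fun L M _ _ _ _ N _ _ _ P P' n =>
      (WeakDerived.tensorIntoDuality R Sᵐᵒᵖ M N).nonempty_relExt_addEquiv P P' n,
    fun L _ _ _ _ M N _ _ _ Q Q' n =>
      (WeakDerived.tensorFromDuality R S L N).nonempty_relExt_addEquiv Q Q' n,
    fun M N P P' Q Q' n =>
      ⟨?_, WeakDerived.nonempty_relTorFlat_addEquiv_relTorInj P' Q' n, ?_⟩⟩
  -- The character statements are the case T = ℤ with the injective module ℚ/ℤ, lifted to universe
  -- `u` and then identified with `CharacterModule`.
  · obtain ⟨e⟩ := (WeakDerived.tensorIntoDuality R ℤ N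
      WeakDerived.QModZ.{u}).nonempty_relExt_addEquiv P P' n
    obtain ⟨e'⟩ := WeakDerived.nonempty_relExt_addEquiv_of_iso P
      (WeakDerived.homRightIsoCharRight R N) n
    exact ⟨e'.symm.trans (e.trans (WeakDerived.homQModZEquiv _))⟩
  · obtain ⟨e⟩ := (WeakDerived.tensorFromDuality R ℤ M
      WeakDerived.QModZ.{u}).nonempty_relExt_addEquiv Q Q' n
    obtain ⟨e'⟩ := WeakDerived.nonempty_relExt_addEquiv_of_iso Q
      (WeakDerived.homLeftIsoCharLeft R M) n
    exact ⟨(WeakDerived.homQModZEquiv _).symm.trans (e.symm.trans e')⟩
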